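/- Let $n\ge 0$, let $\gamma_n$ be the standard Gaussian measure on $\mathbb R^n$, and for $t>0$ let $P_t\delta_x$ be the law of $x+\sqrt t\,Z$ with $Z\sim\gamma_n$, and $P_th(x)=\int h(x+\sqrt t\,z)\,d\gamma_n(z)=\int h\,dP_t\delta_x$ the Euclidean heat semigroup (acting entrywise on matrix-valued functions). For probability measures $\mu\ll\nu$, let $\mathsf H(\mu\|\nu)=\int\log\frac{d\mu}{d\nu}\,d\mu\in[0,+\infty]$ be the relative entropy. Fix $T>0$ and $x\in\mathbb R^n$. Let $f:\mathbb R^n\to\mathbb R$ be a smooth positive function with $\int f\,dP_T\delta_x=1$ such that $P_Tf$ is finite in a neighborhood of $x$, and let $\mu$ be the probability measure with $\frac{d\mu}{dP_T\delta_x}=f$. Then $P_Tf$ is $C^2$ at $x$, and the following hold. (i) If every entry of $f\nabla^2\log f$ is integrable with respect to $P_T\delta_x$, then $\det\big(\mathsf{Id}_n-T\frac{P_T(f\nabla^2\log f)(x)}{P_Tf(x)}\big)>0$ and $$\mathsf H(\mu\|P_T\delta_x)\le\frac T2\,\Delta P_Tf(x)+\frac12P_Tf(x)\log\det\Big(\mathsf{Id}_n-T\,\frac{P_T(f\nabla^2\log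 f)(x)}{P_Tf(x)}\Big).$$ (ii) $\det\big(\mathsf{Id}_n+T\nabla^2\log P_Tf(x)\big)>0$ and $$\mathsf H(\mu\|P_T\delta_x)\ge\frac T2\,\Delta P_Tf(x)-\frac12P_Tf(x)\log\det\Big(\mathsf{Id}_n+T\nabla^2\log P_Tf(x)\Big).$$ -/

import Mathlib

open MeasureTheory ProbabilityTheory Topology
open scoped ContDiff ENNReal

noncomputable section

/-- The measure `P_t δ_x` on `ℝⁿ`: the law of `x + √t Z`, where `Z` is a standard Gaussian vector. -/
def heatMeasure {n : ℕ} (t : ℝ) (x : EuclideanSpace ℝ (Fin n)) :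
    Measure (EuclideanSpace ℝ (Fin n)) :=
  (stdGaussian (EuclideanSpace ℝ (Fin n))).map (fun z => x + Real.sqrt t • z)

/-- The Euclidean heat semigroup `P_t h (x) = ∫ h (x + √t z) dγ_n(z)`, with generator `Δ / 2`. -/
def heatSemigroup {n : ℕ} (t : ℝ) (h : EuclideanSpace ℝ (Fin n) → ℝ)
    (x : EuclideanSpace ℝ (Fin n)) : ℝ :=
  ∫ z, h (x + Real.sqrt t • z) ∂stdGaussian (EuclideanSpace ℝ (Fin n))

/-- The Hessian matrix `(∂_i ∂_j g (x))_{i,j}`. -/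
def hessianMatrix {n : ℕ} (g : EuclideanSpace ℝ (Fin n) → ℝ)
    (x : EuclideanSpace ℝ (Fin n)) : Matrix (Fin n) (Fin n) ℝ :=
  Matrix.of fun i j =>
    iteratedFDeriv ℝ 2 g x ![EuclideanSpace.single i 1, EuclideanSpace.single j 1]

/-- The matrix `P_t (f ∇² log f) (x)`; the semigroup acts entry by entry. -/
def heatHessianLog {n : ℕ} (t : ℝ) (f : EuclideanSpace ℝ (Fin n) → ℝ)
    (x : EuclideanSpace ℝ (Fin n)) : Matrix (Fin n) (Fin n) ℝ :=
  Matrix.of fun i j =>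
    heatSemigroup t (fun y => f y * hessianMatrix (fun w => Real.log (f w)) y i j) x

end

/-!
All measures are written in the coordinates `p ↦ x + √T p`, in which `P_T δ_x` becomes the standard
Gaussian measure on `ℝⁿ`. There `μ` has the Lebesgue density `ρ(p) = f (x + √T p) g(p)`, where `g` is
the Gaussian density, and since `log g` is a quadratic polynomial, the relative entropy
`H(μ ‖ P_T δ_x)` equals `∫ ρ log ρ + (n / 2) log (2π) + (1 / 2) ∑ i, ∫ ρ pᵢ²`.

The Cameron–Martin shift writes `P_T f (y)`, for `y` near `x`, as `exp (-‖k‖² / 2) ∫ exp ⟪p, k⟫ ρ(p)`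
with `k = (y - x) / √T`. Finiteness of `P_T f` near `x` gives `ρ` an exponential moment, so this
function is `C²` and its derivatives at `x` are moments of `ρ` (`heatSemigroup_second_order`):
`T Δ P_T f (x) = ∑ i, (∫ ρ pᵢ² - 1)`, and `1 + T ∇² log P_T f (x)` is the covariance matrix of `ρ`.

Both bounds are thereby bounds for the entropy `∫ ρ log ρ`.

* The lower bound `∫ ρ log ρ ≥ -(n / 2) log (2π e) - (1 / 2) log det C`, with `C` the covariance
  matrix, is Gibbs' inequality against the Gaussian density with the same mean and covariance
  (`covariance_posDef_and_le_entropy`).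
* The upper bound `∫ ρ log ρ ≤ -(n / 2) log (2π e) + (1 / 2) log det M`, with `M` the Fisher
  information matrix, is the Gaussian logarithmic Sobolev inequality after the linear change of
  variables which turns `M` into the identity (`fisher_posDef_and_entropy_le`). Integrability of
  `f ∇² log f` suffices for `M = -∫ ρ ∇² log ρ = 1 - T P_T(f ∇² log f)(x)`: integrating by parts
  twice against a cutoff `ψ` leaves the error `∫ ρ ∂ᵥ²ψ`, which involves no derivative of `ρ`
  (`fisher_information_eq`).

The logarithmic Sobolev inequality itself is proved on the real line with the monotone transport map
(`integrable_klFun_and_integral_le`) and passes to `ℝⁿ` by tensorization of the entropy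
(`entropy_prod_le`).
-/

namespace HeatEntropy

open Set Filter

/-! ### The logarithmic Sobolev inequality on the real line -/

/-- A positive continuous probability density on `ℝ` has a distribution function which is a
differentiable increasing bijection from `ℝ` to `(0, 1)`. -/
lemma exists_distribution_function {ρ : ℝ → ℝ} (hc : Continuous ρ) (hpos : ∀ x, 0 < ρ x)
    (hint : Integrable ρ) (h1 : ∫ x, ρ x = 1) :
    ∃ F : ℝ → ℝ, (∀ x, HasDerivAt F (ρ x) x) ∧ range F = Ioo 0 1 := by
  set F : ℝ → ℝ := fun x => ∫ t in Iic x, ρ t with hF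
  have hFd : ∀ x, HasDerivAt F (ρ x) x := by
    intro x
    have h : HasDerivAt (fun u => F 0 + ∫ t in (0 : ℝ)..u, ρ t) (ρ x) x :=
      (intervalIntegral.integral_hasDerivAt_right (hc.intervalIntegrable _ _)
        hc.aestronglyMeasurable.stronglyMeasurableAtFilter hc.continuousAt).const_add _
    refine h.congr_of_eventuallyEq (Eventually.of_forall fun u => ?_)
    have := intervalIntegral.integral_Iic_sub_Iic (a := 0) (b := u) hint.integrableOn
      hint.integrableOn
    simp only [hF, ← this]
    ring
  have hmono : StrictMono F := strictMono_of_hasDerivAt_pos hFd hpos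
  have hbot : Tendsto F atBot (𝓝 0) := tendsto_integral_Iic_zero tendsto_id
  have htop : Tendsto F atTop (𝓝 1) := by
    have h := (aecover_Iic (μ := volume) (tendsto_id (α := ℝ) (x := atTop)))
      |>.integral_tendsto_of_countably_generated hint
    rwa [h1] at h
  have hcont : Continuous F := continuous_iff_continuousAt.2 fun x => (hFd x).continuousAt
  refine ⟨F, hFd, Subset.antisymm ?_ ?_⟩
  · rintro _ ⟨x, rfl⟩
    constructor
    · exact (hmono.monotone.le_of_tendsto hbot (x - 1)).trans_lt (hmono (by linarith))
    · exact (hmono (by linarith : x < x + 1)).trans_le (hmono.monotone.ge_of_tendsto htop _)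
  · rintro c ⟨hc0, hc1⟩
    refine mem_range_of_exists_le_of_exists_ge hcont ?_ ?_
    · exact ((hbot.eventually_lt_const hc0).exists).imp fun _ h => h.le
    · exact ((htop.eventually_const_lt hc1).exists).imp fun _ h => h.le

/-- The monotone transport map between two positive continuous probability densities. -/
lemma exists_monotone_transport {ρ g : ℝ → ℝ} (hρ : Continuous ρ) (hρpos : ∀ x, 0 < ρ x)
    (hρint : Integrable ρ) (hρ1 : ∫ x, ρ x = 1) (hg : Continuous g) (hgpos : ∀ x, 0 < g x)
    (hgint : Integrable g) (hg1 : ∫ x, g x = 1) :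
    ∃ S : ℝ → ℝ, ∀ x, HasDerivAt S (ρ x / g (S x)) x := by
  obtain ⟨F, hFd, hFr⟩ := exists_distribution_function hρ hρpos hρint hρ1
  obtain ⟨G, hGd, hGr⟩ := exists_distribution_function hg hgpos hgint hg1
  have hFm : StrictMono F := strictMono_of_hasDerivAt_pos hFd hρpos
  have hGm : StrictMono G := strictMono_of_hasDerivAt_pos hGd hgpos
  have hex : ∀ x, ∃ y, G y = F x := fun x => by
    have : F x ∈ range G := by rw [hGr, ← hFr]; exact mem_range_self x
    exact this
  choose S hS using hex
  have hSm : StrictMono S := fun a b hab => hGm.lt_iff_lt.1 (by rw [hS, hS]; exact hFm hab)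
  have hSs : Function.Surjective S := fun y => by
    have : G y ∈ range F := by rw [hFr, ← hGr]; exact mem_range_self y
    obtain ⟨x, hx⟩ := this
    exact ⟨x, hGm.injective (by rw [hS, hx])⟩
  have hSc : Continuous S := hSm.monotone.continuous_of_surjective hSs
  refine ⟨S, fun x => ?_⟩
  have hGs : HasStrictDerivAt G (g (S x)) (S x) :=
    hasStrictDerivAt_of_hasDerivAt_of_continuousAt (Eventually.of_forall hGd) hg.continuousAt
  have hne := (hgpos (S x)).ne'
  have hL := (hGs.to_localInverse hne).hasDerivAt
  rw [hS] at hL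
  have hcomp := hL.comp x (hFd x)
  have hleft : ∀ᶠ y in 𝓝 (S x), hGs.localInverse G (g (S x)) (S x) hne (G y) = y :=
    (hGs.hasStrictFDerivAt_equiv hne).eventually_left_inverse
  have heq : S =ᶠ[𝓝 x] (hGs.localInverse G (g (S x)) (S x) hne) ∘ F := by
    filter_upwards [hSc.continuousAt.eventually hleft] with y hy
    rw [Function.comp_apply, ← hS y, hy]
  refine (hcomp.congr_of_eventuallyEq heq).congr_deriv ?_
  field_simp

/-- The standard Gaussian density on `ℝ`. -/
local notation "φ" => gaussianPDFReal 0 1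

lemma gaussianPDFReal_std_eq (x : ℝ) :
    φ x = (Real.sqrt (2 * Real.pi))⁻¹ * Real.exp (-x ^ 2 / 2) := by
  simp [gaussianPDFReal]

lemma gaussianPDFReal_std_pos (x : ℝ) : 0 < φ x := gaussianPDFReal_pos _ _ _ one_ne_zero

lemma hasDerivAt_gaussianPDFReal_std (x : ℝ) : HasDerivAt φ (-x * φ x) x := by
  have h : HasDerivAt (fun x : ℝ => (Real.sqrt (2 * Real.pi))⁻¹ * Real.exp (-x ^ 2 / 2))
      ((Real.sqrt (2 * Real.pi))⁻¹ * (Real.exp (-x ^ 2 / 2) * (-(2 * x) / 2))) x := by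
    have := ((hasDerivAt_pow 2 x).neg.div_const 2).exp.const_mul (Real.sqrt (2 * Real.pi))⁻¹
    simpa using this
  have h2 : φ = fun x : ℝ => (Real.sqrt (2 * Real.pi))⁻¹ * Real.exp (-x ^ 2 / 2) :=
    funext gaussianPDFReal_std_eq
  rw [h2]
  convert h using 1
  ring

lemma continuous_gaussianPDFReal_std : Continuous φ :=
  continuous_iff_continuousAt.2 fun x => (hasDerivAt_gaussianPDFReal_std x).continuousAt

lemma log_gaussianPDFReal_std (x : ℝ) :
    Real.log (φ x) = -(Real.log (2 * Real.pi) / 2) - x ^ 2 / 2 := by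
  rw [gaussianPDFReal_std_eq, Real.log_mul (by positivity) (Real.exp_ne_zero _), Real.log_inv,
    Real.log_sqrt (by positivity), Real.log_exp]
  ring

lemma gaussianPDFReal_std_le_one (x : ℝ) : φ x ≤ 1 := by
  have h : Real.log (φ x) ≤ 0 := by
    rw [log_gaussianPDFReal_std]
    have : 0 ≤ Real.log (2 * Real.pi) := Real.log_nonneg (by nlinarith [Real.pi_gt_three])
    nlinarith [sq_nonneg x]
  exact (Real.log_nonpos_iff (gaussianPDFReal_std_pos x).le).1 h

/-- The boundary terms produced by the transport map vanish along suitable sequences: the function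
`S ρ` is the derivative of the bounded function `-φ ∘ S`. -/
lemma exists_transport_boundary_small {ρ S : ℝ → ℝ}
    (hS : ∀ x, HasDerivAt S (ρ x / φ (S x)) x) {ε : ℝ} (hε : 0 < ε) (c : ℝ) :
    (∃ b ≥ c, S b * ρ b < ε) ∧ ∃ a ≤ c, -ε < S a * ρ a := by
  have hd : ∀ x, HasDerivAt (fun x => -φ (S x)) (S x * ρ x) x := by
    intro x
    refine ((hasDerivAt_gaussianPDFReal_std (S x)).comp x (hS x)).neg.congr_deriv ?_
    have := (gaussianPDFReal_std_pos (S x)).ne'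
    field_simp
  have hdiff : Differentiable ℝ (fun x => -φ (S x)) := fun x => (hd x).differentiableAt
  have hb : ∀ x y, -φ (S x) - -φ (S y) ≤ 1 := fun x y => by
    have h1 := gaussianPDFReal_std_le_one (S y)
    have h2 := gaussianPDFReal_std_pos (S x)
    linarith
  constructor
  · by_contra! h
    have := (convex_Ici c).mul_sub_le_image_sub_of_le_deriv hdiff.continuous.continuousOn
      hdiff.differentiableOn (C := ε) (fun x hx => by
        rw [(hd x).deriv]; exact h x (interior_subset hx))
      c (mem_Ici.2 le_rfl) (c + 2 / ε) (mem_Ici.2 (by linarith [div_pos two_pos hε]))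
      (by linarith [div_pos two_pos hε])
    have h3 := hb (c + 2 / ε) c
    have h4 : ε * (c + 2 / ε - c) = 2 := by field_simp; ring
    linarith
  · by_contra! h
    have := (convex_Iic c).image_sub_le_mul_sub_of_deriv_le hdiff.continuous.continuousOn
      hdiff.differentiableOn (C := -ε) (fun x hx => by
        rw [(hd x).deriv]; exact h x (mem_Iic.1 (interior_subset hx)))
      (c - 2 / ε) (mem_Iic.2 (by linarith [div_pos two_pos hε])) c (mem_Iic.2 le_rfl)
      (by linarith [div_pos two_pos hε])
    have h3 := hb (c - 2 / ε) c
    have h4 : ε * (c - (c - 2 / ε)) = 2 := by field_simp; ring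
    linarith

/-- The transport proof of the logarithmic Sobolev inequality on a bounded interval. -/
lemma intervalIntegral_mul_log_mul_gaussian_le {f f' S : ℝ → ℝ} (hpos : ∀ x, 0 < f x)
    (hf : ∀ x, HasDerivAt f (f' x) x) (hf' : Continuous f')
    (hS : ∀ x, HasDerivAt S (f x * φ x / φ (S x)) x) {a b : ℝ} (hab : a ≤ b) :
    ∫ x in a..b, f x * Real.log (f x) * φ x ≤
      (S b - b) * (f b * φ b) - (S a - a) * (f a * φ a)
        + ∫ x in a..b, f' x ^ 2 / (2 * f x) * φ x := by
  have hfc : Continuous f := continuous_iff_continuousAt.2 fun x => (hf x).continuousAt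
  have hSc : Continuous S := continuous_iff_continuousAt.2 fun x => (hS x).continuousAt
  have hφc := continuous_gaussianPDFReal_std
  have hf0 : ∀ x, f x ≠ 0 := fun x => (hpos x).ne'
  have hφ0 : ∀ x, φ x ≠ 0 := fun x => (gaussianPDFReal_std_pos x).ne'
  set Q : ℝ → ℝ := fun x => (f x * φ x / φ (S x) - 1) * (f x * φ x)
    + (S x - x) * (f' x * φ x + f x * (-x * φ x)) with hQ
  have hQd : ∀ x, HasDerivAt (fun x => (S x - x) * (f x * φ x)) (Q x) x := fun x =>
    ((hS x).sub (hasDerivAt_id x)).mul ((hf x).mul (hasDerivAt_gaussianPDFReal_std x))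
  have hQc : Continuous Q := by
    have : Continuous fun x => f x * φ x / φ (S x) :=
      (hfc.mul hφc).div (hφc.comp hSc) fun x => hφ0 _
    fun_prop
  have hIc : Continuous fun x => f' x ^ 2 / (2 * f x) * φ x :=
    ((hf'.pow 2).div (continuous_const.mul hfc) fun x => by simpa using hf0 x).mul hφc
  have hLc : Continuous fun x => f x * Real.log (f x) * φ x :=
    (hfc.mul (hfc.log hf0)).mul hφc
  rw [← intervalIntegral.integral_eq_sub_of_hasDerivAt (fun x _ => hQd x)
    (hQc.intervalIntegrable _ _), ← intervalIntegral.integral_add (hQc.intervalIntegrable _ _)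
    (hIc.intervalIntegrable _ _)]
  refine intervalIntegral.integral_mono_on hab (hLc.intervalIntegrable _ _)
    ((hQc.add hIc).intervalIntegrable _ _) fun x _ => ?_
  have hlog := Real.log_le_sub_one_of_pos
    (div_pos (mul_pos (hpos x) (gaussianPDFReal_std_pos x)) (gaussianPDFReal_std_pos (S x)))
  rw [Real.log_div (mul_ne_zero (hf0 x) (hφ0 x)) (hφ0 _), Real.log_mul (hf0 x) (hφ0 x),
    log_gaussianPDFReal_std, log_gaussianPDFReal_std] at hlog
  have hlog' : Real.log (f x) ≤ f x * φ x / φ (S x) - 1 + x ^ 2 / 2 - S x ^ 2 / 2 := by linarith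
  have hsq : 0 ≤ f' x ^ 2 / (2 * f x) + (S x - x) * f' x + f x * (S x - x) ^ 2 / 2 := by
    have : f' x ^ 2 / (2 * f x) + (S x - x) * f' x + f x * (S x - x) ^ 2 / 2
        = (f' x + f x * (S x - x)) ^ 2 / (2 * f x) := by
      have := hf0 x
      field_simp
      ring
    rw [this]
    have := hpos x
    positivity
  have h1 := mul_le_mul_of_nonneg_left hlog' (hpos x).le
  have h2 : f x * Real.log (f x) ≤ f' x ^ 2 / (2 * f x) + (f x * φ x / φ (S x) - 1) * f x
      + (S x - x) * (f' x - x * f x) := by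
    nlinarith
  calc f x * Real.log (f x) * φ x
      ≤ (f' x ^ 2 / (2 * f x) + (f x * φ x / φ (S x) - 1) * f x
        + (S x - x) * (f' x - x * f x)) * φ x :=
        mul_le_mul_of_nonneg_right h2 (gaussianPDFReal_std_pos x).le
    _ = Q x + f' x ^ 2 / (2 * f x) * φ x := by rw [hQ]; ring

/-- The one-dimensional logarithmic Sobolev inequality for a probability density with finite
Fisher information. -/
lemma integrable_klFun_and_integral_le {f f' : ℝ → ℝ} (hpos : ∀ x, 0 < f x)
    (hf : ∀ x, HasDerivAt f (f' x) x) (hf' : Continuous f')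
    (hint : Integrable fun x => f x * φ x) (h1 : ∫ x, f x * φ x = 1)
    (hJ : Integrable fun x => f' x ^ 2 / (2 * f x) * φ x) :
    Integrable (fun x => InformationTheory.klFun (f x) * φ x) ∧
      ∫ x, InformationTheory.klFun (f x) * φ x ≤ ∫ x, f' x ^ 2 / (2 * f x) * φ x := by
  have hfc : Continuous f := continuous_iff_continuousAt.2 fun x => (hf x).continuousAt
  have hφc := continuous_gaussianPDFReal_std
  have hf0 : ∀ x, f x ≠ 0 := fun x => (hpos x).ne'
  have hφi : Integrable φ := integrable_gaussianPDFReal 0 1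
  have hφ1 : ∫ x, φ x = 1 := integral_gaussianPDFReal_eq_one 0 one_ne_zero
  obtain ⟨S, hS⟩ := exists_monotone_transport
    (ρ := fun x => f x * φ x) (hfc.mul hφc)
    (fun x => mul_pos (hpos x) (gaussianPDFReal_std_pos x)) hint h1 hφc gaussianPDFReal_std_pos
    hφi hφ1
  have hε : ∀ k : ℕ, (0 : ℝ) < 1 / (k + 1) := fun k => by positivity
  have hb := fun k : ℕ => (exists_transport_boundary_small hS (hε k) (k : ℝ)).1
  have ha := fun k : ℕ => (exists_transport_boundary_small hS (hε k) (-(k : ℝ))).2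
  choose b hbk hbS using hb
  choose a hak haS using ha
  have hbt : Tendsto b atTop atTop := tendsto_atTop_mono hbk tendsto_natCast_atTop_atTop
  have hat : Tendsto a atTop atBot :=
    tendsto_atBot_mono hak (tendsto_neg_atTop_atBot.comp tendsto_natCast_atTop_atTop)
  have hLc : Continuous fun x => f x * Real.log (f x) * φ x :=
    (hfc.mul (hfc.log hf0)).mul hφc
  have hKc : Continuous fun x => InformationTheory.klFun (f x) * φ x :=
    (InformationTheory.continuous_klFun.comp hfc).mul hφc
  set D : ℝ → ℝ := fun x => φ x - f x * φ x with hD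
  have hDi : Integrable D := hφi.sub hint
  have hD0 : ∫ x, D x = 0 := by
    rw [hD, integral_sub hφi hint, hφ1, h1, sub_self]
  set J := ∫ x, f' x ^ 2 / (2 * f x) * φ x with hJdef
  have hkey : ∀ k : ℕ, ∫ x in a k..b k, InformationTheory.klFun (f x) * φ x ≤
      2 * (1 / ((k : ℝ) + 1)) + J + ∫ x in a k..b k, D x := by
    intro k
    have hk : (0 : ℝ) ≤ k := k.cast_nonneg
    have hab : a k ≤ b k := by linarith [hak k, hbk k]
    have h2 : ∫ x in a k..b k, InformationTheory.klFun (f x) * φ x =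
        (∫ x in a k..b k, f x * Real.log (f x) * φ x) + ∫ x in a k..b k, D x := by
      rw [← intervalIntegral.integral_add (hLc.intervalIntegrable _ _) hDi.intervalIntegrable]
      refine intervalIntegral.integral_congr fun x _ => ?_
      simp only [InformationTheory.klFun_apply, hD]
      ring
    have h3 := intervalIntegral_mul_log_mul_gaussian_le hpos hf hf' hS hab
    have h4 : ∫ x in a k..b k, f' x ^ 2 / (2 * f x) * φ x ≤ J := by
      rw [intervalIntegral.integral_of_le hab]
      refine setIntegral_le_integral hJ (Eventually.of_forall fun x => ?_)
      have := hpos x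
      have := gaussianPDFReal_std_pos x
      simp only [Pi.zero_apply]
      positivity
    have h5 : (S (b k) - b k) * (f (b k) * φ (b k)) ≤ 1 / ((k : ℝ) + 1) := by
      have := mul_nonneg (hk.trans (hbk k))
        (mul_pos (hpos (b k)) (gaussianPDFReal_std_pos (b k))).le
      have := hbS k
      nlinarith
    have h6 : -(1 / ((k : ℝ) + 1)) ≤ (S (a k) - a k) * (f (a k) * φ (a k)) := by
      have := mul_nonneg (by linarith [hak k] : 0 ≤ -a k)
        (mul_pos (hpos (a k)) (gaussianPDFReal_std_pos (a k))).le
      have := haS k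
      nlinarith
    rw [h2]
    linarith
  have hDt := intervalIntegral_tendsto_integral hDi hat hbt
  have hrhs : Tendsto (fun k : ℕ => 2 * (1 / ((k : ℝ) + 1)) + J + ∫ x in a k..b k, D x) atTop
      (𝓝 J) := by
    have := ((tendsto_one_div_add_atTop_nhds_zero_nat (𝕜 := ℝ)).const_mul 2).add_const J |>.add hDt
    rw [hD0] at this
    simpa using this
  have hnonneg : ∀ x, 0 ≤ InformationTheory.klFun (f x) * φ x := fun x =>
    mul_nonneg (InformationTheory.klFun_nonneg (hpos x).le) (gaussianPDFReal_std_pos x).le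
  have hKi : Integrable fun x => InformationTheory.klFun (f x) * φ x := by
    refine integrable_of_intervalIntegral_norm_bounded (l := atTop) (J + 1)
      (fun k => hKc.integrableOn_Ioc) hat hbt ?_
    filter_upwards [hrhs.eventually_le_const (by linarith : J < J + 1)] with k hk
    simp_rw [Real.norm_of_nonneg (hnonneg _)]
    exact (hkey k).trans hk
  exact ⟨hKi, le_of_tendsto_of_tendsto' (intervalIntegral_tendsto_integral hKi hat hbt) hrhs hkey⟩

/-! ### Entropy of a positive function and its tensorization -/

/-- The entropy `∫ f log (f / ∫ f)` of a positive function with respect to a probability measure.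
The two terms added to the integrand have total integral zero and make it nonnegative, so that the
entropy is defined in `[0, ∞]` without an integrability assumption on `f log f`. -/
noncomputable def entropy {X : Type*} [MeasurableSpace X] (ν : Measure X) (f : X → ℝ) : ℝ≥0∞ :=
  ∫⁻ x, ENNReal.ofReal (f x * Real.log (f x / ∫ y, f y ∂ν) - f x + ∫ y, f y ∂ν) ∂ν

/-- The tangent line inequality behind the nonnegativity and the convexity of the entropy. -/
lemma mul_log_add_sub_le {a b s : ℝ} (ha : 0 < a) (hb : 0 < b) (hs : 0 < s) :
    a * Real.log s - b * s + b ≤ a * Real.log (a / b) - a + b := by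
  have h := Real.log_le_sub_one_of_pos (div_pos (mul_pos hb hs) ha)
  rw [Real.log_div (by positivity) ha.ne', Real.log_mul hb.ne' hs.ne'] at h
  rw [Real.log_div ha.ne' hb.ne']
  have h2 := mul_le_mul_of_nonneg_left h ha.le
  have h3 : a * (b * s / a - 1) = b * s - a := by field_simp
  nlinarith

lemma ofReal_integral_le_lintegral {X : Type*} [MeasurableSpace X] {ν : Measure X} {f : X → ℝ}
    (hf : Integrable f ν) : ENNReal.ofReal (∫ x, f x ∂ν) ≤ ∫⁻ x, ENNReal.ofReal (f x) ∂ν := by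
  calc ENNReal.ofReal (∫ x, f x ∂ν) ≤ ENNReal.ofReal (∫ x, max (f x) 0 ∂ν) :=
        ENNReal.ofReal_le_ofReal (integral_mono hf hf.pos_part fun x => le_max_left _ _)
    _ = ∫⁻ x, ENNReal.ofReal (max (f x) 0) ∂ν :=
        ofReal_integral_eq_lintegral_ofReal hf.pos_part
          (Eventually.of_forall fun x => le_max_right _ _)
    _ = ∫⁻ x, ENNReal.ofReal (f x) ∂ν := by simp [ENNReal.ofReal_max]

section Prod

variable {X Y : Type*} [MeasurableSpace X] [MeasurableSpace Y] {μ : Measure X} {ν : Measure Y}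
  [IsProbabilityMeasure μ] [IsProbabilityMeasure ν]

lemma integral_pos_of_forall_pos {f : X → ℝ} (hpos : ∀ x, 0 < f x) (hf : Integrable f μ) :
    0 < ∫ x, f x ∂μ := by
  rw [integral_pos_iff_support_of_nonneg (fun x => (hpos x).le) hf]
  have : Function.support f = univ := by
    ext x; simp [(hpos x).ne']
  simp [this]

/-- One step of the chain rule for the entropy: the entropy relative to the value `M` is bounded by
the entropy plus the contribution of the mean. -/
lemma lintegral_mul_log_le_entropy_add {f : X → ℝ} (hm : Measurable f) (hpos : ∀ x, 0 < f x)
    (hf : Integrable f μ) {M : ℝ} (hM : 0 < M) :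
    ∫⁻ x, ENNReal.ofReal (f x * Real.log (f x / M) - f x + M) ∂μ ≤
      entropy μ f + ENNReal.ofReal
        ((∫ x, f x ∂μ) * Real.log ((∫ x, f x ∂μ) / M) - (∫ x, f x ∂μ) + M) := by
  set F := ∫ x, f x ∂μ with hF
  have hFpos : 0 < F := integral_pos_of_forall_pos hpos hf
  by_cases htop : entropy μ f = ⊤
  · simp [htop]
  set A : X → ℝ := fun x => f x * Real.log (f x / F) - f x + F with hA
  have hA0 : ∀ x, 0 ≤ A x := fun x => by
    simpa using mul_log_add_sub_le (hpos x) hFpos one_pos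
  have hAm : Measurable A := by fun_prop
  have hAi : Integrable A μ := by
    rw [← lintegral_ofReal_ne_top_iff_integrable hAm.aestronglyMeasurable
      (Eventually.of_forall hA0)]
    exact htop
  have heq : ∀ x, f x * Real.log (f x / M) - f x + M = A x + (f x * Real.log (F / M) + (M - F)) := by
    intro x
    rw [hA]
    simp only
    rw [Real.log_div (hpos x).ne' hM.ne', Real.log_div (hpos x).ne' hFpos.ne',
      Real.log_div hFpos.ne' hM.ne']
    ring
  have hBi : Integrable (fun x => f x * Real.log (F / M) + (M - F)) μ :=
    (hf.mul_const _).add (integrable_const _)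
  have hB : ∫ x, (f x * Real.log (F / M) + (M - F)) ∂μ = F * Real.log (F / M) - F + M := by
    rw [integral_add (hf.mul_const _) (integrable_const _), integral_mul_const]
    simp
    ring
  simp_rw [heq]
  rw [← ofReal_integral_eq_lintegral_ofReal (hAi.fun_add hBi) (Eventually.of_forall fun x => by
    have := mul_log_add_sub_le (hpos x) hM one_pos
    simp only [Pi.zero_apply]
    rw [← heq]
    simpa using this)]
  rw [integral_add hAi hBi, hB, entropy,
    ← ofReal_integral_eq_lintegral_ofReal hAi (Eventually.of_forall hA0)]
  exact ENNReal.ofReal_add_le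

/-- **Tensorization of entropy** for a product of two probability spaces. -/
lemma entropy_prod_le {f : X × Y → ℝ} (hm : Measurable f) (hpos : ∀ p, 0 < f p)
    (hf : Integrable f (μ.prod ν)) :
    entropy (μ.prod ν) f ≤
      ∫⁻ y, entropy μ (fun x => f (x, y)) ∂ν + ∫⁻ x, entropy ν (fun y => f (x, y)) ∂μ := by
  set M := ∫ p, f p ∂(μ.prod ν) with hM
  have hMpos : 0 < M := integral_pos_of_forall_pos hpos hf
  set F : Y → ℝ := fun y => ∫ x, f (x, y) ∂μ with hF
  set G : X → ℝ := fun x => ∫ y, f (x, y) ∂ν with hG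
  have hGi : Integrable G μ := hf.integral_prod_left
  have hGm : Measurable G := hm.stronglyMeasurable.integral_prod_right'.measurable
  have hGM : ∫ x, G x ∂μ = M := (integral_prod f hf).symm
  have hGpos : ∀ᵐ x ∂μ, 0 < G x := by
    filter_upwards [hf.prod_right_ae] with x hx
    exact integral_pos_of_forall_pos (fun y => hpos _) hx
  set K : X → Y → ℝ≥0∞ := fun x y =>
    ENNReal.ofReal (f (x, y) * Real.log (f (x, y) / G x) - f (x, y) + G x) with hK
  have hKm : Measurable (Function.uncurry K) := by
    rw [hK]
    unfold Function.uncurry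
    fun_prop
  have hstep : ∀ᵐ y ∂ν,
      ∫⁻ x, ENNReal.ofReal (f (x, y) * Real.log (f (x, y) / M) - f (x, y) + M) ∂μ ≤
        entropy μ (fun x => f (x, y)) + ∫⁻ x, K x y ∂μ := by
    filter_upwards [hf.prod_left_ae] with y hy
    refine (lintegral_mul_log_le_entropy_add (by fun_prop) (fun x => hpos _) hy hMpos).trans ?_
    gcongr
    have hFpos : 0 < F y := integral_pos_of_forall_pos (fun x => hpos _) hy
    have hi' : Integrable (fun x => f (x, y) * Real.log (F y / M) - G x * (F y / M)) μ :=
      (hy.mul_const _).sub (hGi.mul_const _)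
    have hi : Integrable (fun x => f (x, y) * Real.log (F y / M) - G x * (F y / M) + G x) μ :=
      hi'.add hGi
    have hval : ∫ x, (f (x, y) * Real.log (F y / M) - G x * (F y / M) + G x) ∂μ =
        F y * Real.log (F y / M) - F y + M := by
      rw [integral_add hi' hGi,
        integral_sub (hy.mul_const _) (hGi.mul_const _), integral_mul_const, integral_mul_const,
        hGM, mul_div_cancel₀ _ hMpos.ne']
    rw [← hval]
    refine (ofReal_integral_le_lintegral hi).trans (lintegral_mono_ae ?_)
    filter_upwards [hGpos] with x hx
    exact ENNReal.ofReal_le_ofReal (mul_log_add_sub_le (hpos _) hx (div_pos hFpos hMpos))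
  have hm' : Measurable fun p : X × Y =>
      ENNReal.ofReal (f p * Real.log (f p / M) - f p + M) := by fun_prop
  calc entropy (μ.prod ν) f
      = ∫⁻ y, ∫⁻ x, ENNReal.ofReal (f (x, y) * Real.log (f (x, y) / M) - f (x, y) + M) ∂μ ∂ν :=
        lintegral_prod_symm _ hm'.aemeasurable
    _ ≤ ∫⁻ y, (entropy μ (fun x => f (x, y)) + ∫⁻ x, K x y ∂μ) ∂ν := lintegral_mono_ae hstep
    _ = ∫⁻ y, entropy μ (fun x => f (x, y)) ∂ν + ∫⁻ y, ∫⁻ x, K x y ∂μ ∂ν :=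
        lintegral_add_right _ hKm.lintegral_prod_left
    _ = ∫⁻ y, entropy μ (fun x => f (x, y)) ∂ν + ∫⁻ x, entropy ν (fun y => f (x, y)) ∂μ := by
        rw [← lintegral_lintegral_swap hKm.aemeasurable]
        rfl

end Prod

lemma entropy_comp_of_measurePreserving {X Y : Type*} [MeasurableSpace X] [MeasurableSpace Y]
    {μ : Measure X} {ν : Measure Y} {e : X ≃ᵐ Y} (he : MeasurePreserving e μ ν) (f : X → ℝ) :
    entropy μ f = entropy ν (f ∘ e.symm) := by
  have h : ∫ y, f (e.symm y) ∂ν = ∫ x, f x ∂μ := by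
    simpa using (he.integral_comp' (fun y => f (e.symm y))).symm
  have h2 := he.lintegral_comp_emb e.measurableEmbedding
    fun y => ENNReal.ofReal (f (e.symm y) * Real.log (f (e.symm y) / ∫ x, f x ∂μ)
      - f (e.symm y) + ∫ x, f x ∂μ)
  simp only [entropy, Function.comp_apply, h, ← h2, MeasurableEquiv.symm_apply_apply]

/-! ### The Gaussian logarithmic Sobolev inequality -/

lemma integrable_gaussianReal_std_iff {h : ℝ → ℝ} :
    Integrable h (gaussianReal 0 1) ↔ Integrable fun x => h x * φ x := by
  rw [gaussianReal_of_var_ne_zero 0 one_ne_zero, integrable_withDensity_iff_integrable_smul'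
    (measurable_gaussianPDF 0 1) (Eventually.of_forall fun _ => gaussianPDF_lt_top)]
  simp [mul_comm]

lemma integral_gaussianReal_std (h : ℝ → ℝ) :
    ∫ x, h x ∂gaussianReal 0 1 = ∫ x, h x * φ x := by
  rw [integral_gaussianReal_eq_integral_smul one_ne_zero]
  simp [mul_comm]

/-- The Gaussian logarithmic Sobolev inequality on `ℝ`, for a positive integrable function of any
mass and with a right-hand side which may be infinite. -/
theorem gaussianReal_logSobolev {f f' : ℝ → ℝ} (hpos : ∀ x, 0 < f x)
    (hf : ∀ x, HasDerivAt f (f' x) x) (hf' : Continuous f')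
    (hint : Integrable f (gaussianReal 0 1)) :
    entropy (gaussianReal 0 1) f ≤
      ∫⁻ x, ENNReal.ofReal (f' x ^ 2 / (2 * f x)) ∂gaussianReal 0 1 := by
  have hfc : Continuous f := continuous_iff_continuousAt.2 fun x => (hf x).continuousAt
  by_cases htop : ∫⁻ x, ENNReal.ofReal (f' x ^ 2 / (2 * f x)) ∂gaussianReal 0 1 = ⊤
  · simp [htop]
  have hJnn : ∀ x, 0 ≤ f' x ^ 2 / (2 * f x) := fun x => by
    have := hpos x
    positivity
  have hJm : Measurable fun x => f' x ^ 2 / (2 * f x) := by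
    have := hf'.measurable
    have := hfc.measurable
    fun_prop
  have hJi := (lintegral_ofReal_ne_top_iff_integrable hJm.aestronglyMeasurable
    (Eventually.of_forall hJnn)).1 htop
  set m := ∫ x, f x ∂gaussianReal 0 1 with hm
  have hmpos : 0 < m := integral_pos_of_forall_pos hpos hint
  have hJ' : ∀ x, (f' x / m) ^ 2 / (2 * (f x / m)) = m⁻¹ * (f' x ^ 2 / (2 * f x)) := fun x => by
    have := (hpos x).ne'
    field_simp
  have hint' : Integrable (fun x => f x / m) (gaussianReal 0 1) := hint.div_const m
  obtain ⟨h1, h2⟩ := integrable_klFun_and_integral_le (f := fun x => f x / m)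
    (f' := fun x => f' x / m) (fun x => div_pos (hpos x) hmpos)
    (fun x => (hf x).div_const m) (hf'.div_const m)
    (integrable_gaussianReal_std_iff.1 hint')
    (by rw [← integral_gaussianReal_std (fun x => f x / m), integral_div, div_self hmpos.ne'])
    (by
      simp_rw [hJ']
      exact integrable_gaussianReal_std_iff.1 (hJi.const_mul _))
  rw [← integral_gaussianReal_std (fun x => InformationTheory.klFun (f x / m)),
    ← integral_gaussianReal_std (fun x => (f' x / m) ^ 2 / (2 * (f x / m)))] at h2
  have h1' := integrable_gaussianReal_std_iff.2 h1
  simp_rw [hJ'] at h2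
  rw [integral_const_mul] at h2
  have hent : ∀ x, f x * Real.log (f x / m) - f x + m = m * InformationTheory.klFun (f x / m) :=
    fun x => by
      rw [InformationTheory.klFun_apply]
      field_simp
      ring
  rw [entropy, ← hm, ← ofReal_integral_eq_lintegral_ofReal hJi (Eventually.of_forall hJnn)]
  simp_rw [hent]
  rw [← ofReal_integral_eq_lintegral_ofReal (h1'.const_mul m) (Eventually.of_forall fun x =>
    mul_nonneg hmpos.le (InformationTheory.klFun_nonneg (div_pos (hpos x) hmpos).le)),
    integral_const_mul]
  refine ENNReal.ofReal_le_ofReal ?_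
  calc _ ≤ m * (m⁻¹ * ∫ x, f' x ^ 2 / (2 * f x) ∂gaussianReal 0 1) := by gcongr
    _ = _ := by field_simp

/-- **Gaussian logarithmic Sobolev inequality** for a positive function on `ℝⁿ`; here `D i` is the
`i`-th partial derivative. -/
theorem pi_gaussianReal_logSobolev {n : ℕ} {f : (Fin n → ℝ) → ℝ} {D : Fin n → (Fin n → ℝ) → ℝ}
    (hpos : ∀ p, 0 < f p) (hfc : Continuous f) (hDc : ∀ i, Continuous (D i))
    (hf : ∀ i p, HasDerivAt (fun t => f (Function.update p i t)) (D i p) (p i))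
    (hint : Integrable f (Measure.pi fun _ => gaussianReal 0 1)) :
    entropy (Measure.pi fun _ => gaussianReal 0 1) f ≤
      ∑ i, ∫⁻ p, ENNReal.ofReal (D i p ^ 2 / (2 * f p)) ∂Measure.pi fun _ => gaussianReal 0 1 := by
  induction n with
  | zero =>
    have hconst : f = fun _ => f 0 := funext fun p => congrArg f (Subsingleton.elim p 0)
    rw [hconst]
    simp [entropy, (hpos _).ne']
  | succ n ih =>
    set γ := Measure.pi fun _ : Fin n => gaussianReal 0 1
    have he := measurePreserving_piFinSuccAbove (fun _ : Fin (n + 1) => gaussianReal 0 1) 0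
    set e := MeasurableEquiv.piFinSuccAbove (fun _ : Fin (n + 1) => ℝ) 0
    have hsymm : ∀ q : ℝ × (Fin n → ℝ), e.symm q = Fin.cons q.1 q.2 := fun q => by
      simp [e, MeasurableEquiv.piFinSuccAbove, Fin.insertNthEquiv]
    have hcons : Continuous fun q : ℝ × (Fin n → ℝ) => (Fin.cons q.1 q.2 : Fin (n + 1) → ℝ) := by
      fun_prop
    have hlin : ∀ g : (Fin (n + 1) → ℝ) → ℝ≥0∞,
        ∫⁻ p, g p ∂(Measure.pi fun _ : Fin (n + 1) => gaussianReal 0 1) =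
          ∫⁻ q : ℝ × (Fin n → ℝ), g (Fin.cons q.1 q.2) ∂((gaussianReal 0 1).prod γ) := fun g => by
      have := he.lintegral_comp_emb e.measurableEmbedding (fun q => g (e.symm q))
      simp only [hsymm] at this
      rw [← this]
      simp [← hsymm]
    have hint' : Integrable (fun q : ℝ × (Fin n → ℝ) => f (Fin.cons q.1 q.2))
        ((gaussianReal 0 1).prod γ) := by
      have := (he.integrable_comp_emb e.measurableEmbedding (g := fun q => f (e.symm q))).1
        (by simpa [Function.comp_def] using hint)
      simpa [hsymm] using this
    have hmeas : ∀ i, Measurable fun q : ℝ × (Fin n → ℝ) =>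
        ENNReal.ofReal (D i (Fin.cons q.1 q.2) ^ 2 / (2 * f (Fin.cons q.1 q.2))) := fun i => by
      have h1 : Measurable fun q : ℝ × (Fin n → ℝ) => D i (Fin.cons q.1 q.2) :=
        ((hDc i).comp hcons).measurable
      have h2 : Measurable fun q : ℝ × (Fin n → ℝ) => f (Fin.cons q.1 q.2) :=
        (hfc.comp hcons).measurable
      fun_prop
    rw [entropy_comp_of_measurePreserving he]
    have hcomp : f ∘ e.symm = fun q : ℝ × (Fin n → ℝ) => f (Fin.cons q.1 q.2) :=
      funext fun q => by rw [Function.comp_apply, hsymm]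
    rw [hcomp, Fin.sum_univ_succ]
    simp_rw [hlin]
    refine (entropy_prod_le (hfc.comp hcons).measurable (fun q => hpos _) hint').trans ?_
    refine add_le_add ?_ ?_
    · rw [lintegral_prod_symm _ (hmeas 0).aemeasurable]
      refine lintegral_mono_ae ?_
      filter_upwards [hint'.prod_left_ae] with q hq
      refine gaussianReal_logSobolev (fun t => hpos _) (fun t => ?_) ?_ hq
      · simpa using hf 0 (Fin.cons t q)
      · exact (hDc 0).comp (hcons.comp (by fun_prop : Continuous fun t : ℝ => (t, q)))
    · simp_rw [lintegral_prod _ (hmeas _).aemeasurable]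
      rw [← lintegral_finsetSum _ fun i _ => (hmeas _).lintegral_prod_right]
      refine lintegral_mono_ae ?_
      filter_upwards [hint'.prod_right_ae] with t ht
      have hct : Continuous fun q : Fin n → ℝ => (Fin.cons t q : Fin (n + 1) → ℝ) :=
        hcons.comp (by fun_prop : Continuous fun q : Fin n → ℝ => (t, q))
      refine ih (D := fun i q => D i.succ (Fin.cons t q)) (fun q => hpos _) (hfc.comp hct)
        (fun i => (hDc _).comp hct) (fun i q => ?_) ht
      simpa [Fin.cons_update] using hf i.succ (Fin.cons t q)

/-! ### Integration by parts for a smooth positive density -/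

lemma fderiv_exp_apply {E : Type*} [NormedAddCommGroup E] [NormedSpace ℝ E]
    {V : E → ℝ} (hV : Differentiable ℝ V) (p v : E) :
    fderiv ℝ (fun q => Real.exp (V q)) p v = Real.exp (V p) * fderiv ℝ V p v := by
  rw [fderiv_exp (hV p)]
  simp

section IntegrationByParts

variable {E : Type*} [NormedAddCommGroup E] [NormedSpace ℝ E] [FiniteDimensional ℝ E]

/-- Smooth cutoff functions `ψ k` equal to `1` on the ball of radius `k`, whose second derivatives
in a fixed direction tend to zero uniformly. -/
lemma exists_cutoff_sequence (v : E) : ∃ ψ : ℕ → E → ℝ, (∀ k, ContDiff ℝ 2 (ψ k)) ∧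
    (∀ k, HasCompactSupport (ψ k)) ∧ (∀ k p, 0 ≤ ψ k p) ∧ (∀ k p, ψ k p ≤ 1) ∧
    (∀ (k : ℕ) p, ‖p‖ ≤ k → ψ k p = 1) ∧
    ∃ C, ∀ (k : ℕ) p, |fderiv ℝ (fun q => fderiv ℝ (ψ k) q v) p v| ≤ C * (1 / ((k : ℝ) + 1)) := by
  let b : ContDiffBump (0 : E) := ⟨1, 2, one_pos, by norm_num⟩
  have hb : ContDiff ℝ 2 b := b.contDiff (n := 2)
  have hk : ∀ k : ℕ, (0 : ℝ) < k + 1 := fun k => by positivity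
  set B : E → ℝ := fun p => fderiv ℝ (fun q => fderiv ℝ b q v) p v with hB
  have hb1 : ContDiff ℝ 1 (fun q => fderiv ℝ b q v) :=
    (hb.fderiv_right (m := 1) (by norm_num)).clm_apply contDiff_const
  have hBc : Continuous B :=
    ((hb1.fderiv_right (m := 0) (by norm_num)).clm_apply contDiff_const).continuous
  have hBs : HasCompactSupport B :=
    (b.hasCompactSupport.fderiv_apply ℝ v).fderiv_apply ℝ v
  obtain ⟨C, hC⟩ := hBc.bounded_above_of_compact_support hBs
  refine ⟨fun k p => b (((k : ℝ) + 1)⁻¹ • p), fun k => hb.comp (contDiff_const_smul _),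
    fun k => b.hasCompactSupport.comp_smul (inv_ne_zero (hk k).ne'), fun k p => b.nonneg,
    fun k p => b.le_one, fun k p hp => b.one_of_mem_closedBall ?_, C, fun k p => ?_⟩
  · rw [mem_closedBall_zero_iff, norm_smul, norm_inv, Real.norm_of_nonneg (hk k).le,
      inv_mul_le_iff₀ (hk k)]
    change _ ≤ ((k : ℝ) + 1) * 1
    linarith
  · obtain ⟨g, hg⟩ : ∃ g : E → ℝ, g = fun q => fderiv ℝ b q v := ⟨_, rfl⟩
    have h1 : (fun q => fderiv ℝ (fun p => b (((k : ℝ) + 1)⁻¹ • p)) q v) =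
        fun q => ((k : ℝ) + 1)⁻¹ • g (((k : ℝ) + 1)⁻¹ • q) := by
      ext q
      rw [fderiv_comp_smul]
      simp [hg]
    have h2 : fderiv ℝ (fun q => fderiv ℝ (fun p => b (((k : ℝ) + 1)⁻¹ • p)) q v) p v =
        ((k : ℝ) + 1)⁻¹ * (((k : ℝ) + 1)⁻¹ * B (((k : ℝ) + 1)⁻¹ • p)) := by
      rw [h1, fderiv_fun_const_smul, fderiv_comp_smul]
      · simp [hB, hg]
      · rw [hg]
        exact ((hb1.comp (contDiff_const_smul _)).differentiable (by norm_num)) p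
    have h3 : ((k : ℝ) + 1)⁻¹ ≤ 1 := inv_le_one_of_one_le₀ (by linarith [k.cast_nonneg (α := ℝ)])
    have h4 : 0 < ((k : ℝ) + 1)⁻¹ := inv_pos.2 (hk k)
    rw [h2, abs_mul, abs_mul, abs_of_pos h4, one_div, mul_comm C]
    refine mul_le_mul_of_nonneg_left ?_ h4.le
    calc _ ≤ 1 * |B (((k : ℝ) + 1)⁻¹ • p)| := by gcongr
      _ ≤ C := by rw [one_mul]; exact hC _

variable [MeasurableSpace E] [BorelSpace E] {μ : Measure E} [μ.IsAddHaarMeasure]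

/-- Integration by parts against a cutoff function, with two derivatives moved. -/
lemma integral_cutoff_mul_second_deriv {V ψ : E → ℝ} (hV : ContDiff ℝ 2 V) (hψ : ContDiff ℝ 2 ψ)
    (hs : HasCompactSupport ψ) (v : E) :
    ∫ p, ψ p * (Real.exp (V p) *
        (fderiv ℝ (fun q => fderiv ℝ V q v) p v + fderiv ℝ V p v ^ 2)) ∂μ =
      ∫ p, fderiv ℝ (fun q => fderiv ℝ ψ q v) p v * Real.exp (V p) ∂μ := by
  have hVd : Differentiable ℝ V := hV.differentiable (by norm_num)
  have hV1 : ContDiff ℝ 1 (fun q => fderiv ℝ V q v) :=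
    (hV.fderiv_right (m := 1) (by norm_num)).clm_apply contDiff_const
  have hψ1 : ContDiff ℝ 1 (fun q => fderiv ℝ ψ q v) :=
    (hψ.fderiv_right (m := 1) (by norm_num)).clm_apply contDiff_const
  have hV2 : Continuous fun p => fderiv ℝ (fun q => fderiv ℝ V q v) p v :=
    ((hV1.fderiv_right (m := 0) (by norm_num)).clm_apply contDiff_const).continuous
  have hψ2 : Continuous fun p => fderiv ℝ (fun q => fderiv ℝ ψ q v) p v :=
    ((hψ1.fderiv_right (m := 0) (by norm_num)).clm_apply contDiff_const).continuous
  set u : E → ℝ := fun p => Real.exp (V p) * fderiv ℝ V p v with hu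
  have hu1 : ContDiff ℝ 1 u := ((hV.of_le (by norm_num)).exp).mul hV1
  have hud : ∀ p, fderiv ℝ u p v =
      Real.exp (V p) * (fderiv ℝ (fun q => fderiv ℝ V q v) p v + fderiv ℝ V p v ^ 2) := by
    intro p
    rw [hu, fderiv_fun_mul (hVd.exp p) (hV1.differentiable (by norm_num) p)]
    simp only [add_apply, smul_apply, smul_eq_mul]
    rw [fderiv_exp_apply hVd]
    ring
  have hud' : Continuous fun p => fderiv ℝ u p v :=
    ((hu1.fderiv_right (m := 0) (by norm_num)).clm_apply contDiff_const).continuous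
  have hexp : Continuous fun p => Real.exp (V p) := hV.continuous.rexp
  have hs1 : HasCompactSupport fun p => fderiv ℝ ψ p v := hs.fderiv_apply ℝ v
  have hs2 : HasCompactSupport fun p => fderiv ℝ (fun q => fderiv ℝ ψ q v) p v :=
    hs1.fderiv_apply ℝ v
  have hfirst := integral_mul_fderiv_eq_neg_fderiv_mul_of_integrable (μ := μ) (f := ψ) (g := u)
    (v := v) ((hψ1.continuous.mul hu1.continuous).integrable_of_hasCompactSupport hs1.mul_right)
    ((hψ.continuous.mul hud').integrable_of_hasCompactSupport hs.mul_right)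
    ((hψ.continuous.mul hu1.continuous).integrable_of_hasCompactSupport hs.mul_right)
    (fun p _ => hψ.differentiable (by norm_num) p)
    (fun p _ => hu1.differentiable (by norm_num) p)
  have hue : ∀ p, fderiv ℝ (fun q => Real.exp (V q)) p v = u p := fun p => fderiv_exp_apply hVd p v
  have hsecond := integral_mul_fderiv_eq_neg_fderiv_mul_of_integrable (μ := μ)
    (f := fun p => fderiv ℝ ψ p v) (g := fun p => Real.exp (V p))
    (v := v) ((hψ2.mul hexp).integrable_of_hasCompactSupport hs2.mul_right)
    (by
      simp_rw [hue]
      exact (hψ1.continuous.mul hu1.continuous).integrable_of_hasCompactSupport hs1.mul_right)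
    ((hψ1.continuous.mul hexp).integrable_of_hasCompactSupport hs1.mul_right)
    (fun p _ => hψ1.differentiable (by norm_num) p)
    (fun p _ => (hVd.exp) p)
  simp_rw [hue] at hsecond
  simp_rw [hud] at hfirst
  rw [hfirst, hsecond, neg_neg]

/-- If the density `e^V` and `e^V ∂ᵥ²V` are integrable, then the Fisher information in the
direction `v` is finite and equal to `-∫ e^V ∂ᵥ²V`. No decay of the derivatives has to be assumed:
the cutoff error `∫ e^V ∂ᵥ²ψ` only involves the density itself. -/
lemma fisher_information_eq {V : E → ℝ} (hV : ContDiff ℝ 2 V) (v : E)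
    (hint : Integrable (fun p => Real.exp (V p)) μ)
    (hint2 : Integrable (fun p => Real.exp (V p) * fderiv ℝ (fun q => fderiv ℝ V q v) p v) μ) :
    Integrable (fun p => Real.exp (V p) * fderiv ℝ V p v ^ 2) μ ∧
      ∫ p, Real.exp (V p) * fderiv ℝ V p v ^ 2 ∂μ =
        -∫ p, Real.exp (V p) * fderiv ℝ (fun q => fderiv ℝ V q v) p v ∂μ := by
  obtain ⟨ψ, hψ, hψs, hψ0, hψ1, hψk, C, hC⟩ := exists_cutoff_sequence v
  set H : E → ℝ := fun p => Real.exp (V p) * fderiv ℝ (fun q => fderiv ℝ V q v) p v with hH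
  set J : E → ℝ := fun p => Real.exp (V p) * fderiv ℝ V p v ^ 2 with hJ
  have hV1 : Continuous fun p => fderiv ℝ V p v :=
    ((hV.fderiv_right (m := 0) (by norm_num)).clm_apply contDiff_const).continuous
  have hJc : Continuous J := hV.continuous.rexp.mul (hV1.pow 2)
  have hJ0 : ∀ p, 0 ≤ J p := fun p => by positivity
  -- multiplication by the cutoff functions converges to the full integral
  have hdct : ∀ {g : E → ℝ}, Integrable g μ →
      Tendsto (fun k => ∫ p, ψ k p * g p ∂μ) atTop (𝓝 (∫ p, g p ∂μ)) := by
    intro g hg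
    refine tendsto_integral_of_dominated_convergence (fun p => ‖g p‖)
      (fun k => (hψ k).continuous.aestronglyMeasurable.mul hg.aestronglyMeasurable) hg.norm
      (fun k => Eventually.of_forall fun p => ?_) (Eventually.of_forall fun p => ?_)
    · rw [norm_mul, Real.norm_of_nonneg (hψ0 k p)]
      exact mul_le_of_le_one_left (norm_nonneg _) (hψ1 k p)
    · refine tendsto_const_nhds.congr' ?_
      filter_upwards [tendsto_natCast_atTop_atTop.eventually_ge_atTop ‖p‖] with k hk
      rw [hψk k p hk, one_mul]
  have hmulint : ∀ k {g : E → ℝ}, Integrable g μ → Integrable (fun p => ψ k p * g p) μ :=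
    fun k g hg => hg.bdd_mul (c := 1) (hψ k).continuous.aestronglyMeasurable
      (Eventually.of_forall fun p => by
        rw [Real.norm_of_nonneg (hψ0 k p)]; exact hψ1 k p)
  have hψJ : ∀ k, Integrable (fun p => ψ k p * J p) μ := fun k =>
    ((hψ k).continuous.mul hJc).integrable_of_hasCompactSupport (hψs k).mul_right
  set R : ℕ → ℝ := fun k =>
    ∫ p, fderiv ℝ (fun q => fderiv ℝ (ψ k) q v) p v * Real.exp (V p) ∂μ with hR
  have hkey : ∀ k, ∫ p, ψ k p * J p ∂μ = R k - ∫ p, ψ k p * H p ∂μ := by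
    intro k
    rw [hR]
    simp only
    rw [← integral_cutoff_mul_second_deriv hV (hψ k) (hψs k) v, eq_sub_iff_add_eq,
      ← integral_add (hψJ k) (hmulint k hint2)]
    refine integral_congr_ae (Eventually.of_forall fun p => ?_)
    simp only [hJ, hH]
    ring
  have hR0 : Tendsto R atTop (𝓝 0) := by
    have h1 : Tendsto (fun k : ℕ => C * (1 / ((k : ℝ) + 1)) * ∫ p, Real.exp (V p) ∂μ) atTop
        (𝓝 0) := by
      simpa using ((tendsto_one_div_add_atTop_nhds_zero_nat (𝕜 := ℝ)).const_mul C).mul_const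
        (∫ p, Real.exp (V p) ∂μ)
    refine squeeze_zero_norm (fun k => ?_) h1
    rw [← integral_const_mul]
    refine norm_integral_le_of_norm_le (hint.const_mul _) (Eventually.of_forall fun p => ?_)
    rw [norm_mul, Real.norm_of_nonneg (Real.exp_pos _).le]
    exact mul_le_mul_of_nonneg_right (hC k p) (Real.exp_pos _).le
  have hlim : Tendsto (fun k => ∫ p, ψ k p * J p ∂μ) atTop (𝓝 (-∫ p, H p ∂μ)) := by
    simp_rw [hkey]
    simpa using hR0.sub (hdct hint2)
  have hJi : Integrable J μ := by
    refine (aecover_closedBall (x := (0 : E)) tendsto_natCast_atTop_atTop :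
      AECover μ atTop fun k : ℕ => Metric.closedBall (0 : E) k)
      |>.integrable_of_integral_bounded_of_nonneg_ae (-∫ p, H p ∂μ + 1)
        (fun k => hJc.continuousOn.integrableOn_compact (isCompact_closedBall _ _))
        (Eventually.of_forall hJ0) ?_
    filter_upwards [hlim.eventually_le_const (by linarith :
      -∫ p, H p ∂μ < -∫ p, H p ∂μ + 1)] with k hk
    refine le_trans ?_ hk
    calc ∫ p in Metric.closedBall (0 : E) k, J p ∂μ
        = ∫ p in Metric.closedBall (0 : E) k, ψ k p * J p ∂μ := by
          refine setIntegral_congr_fun Metric.isClosed_closedBall.measurableSet fun p hp => ?_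
          rw [hψk k p (mem_closedBall_zero_iff.1 hp), one_mul]
      _ ≤ ∫ p, ψ k p * J p ∂μ := setIntegral_le_integral (hψJ k)
          (Eventually.of_forall fun p => mul_nonneg (hψ0 k p) (hJ0 p))
  exact ⟨hJi, tendsto_nhds_unique (hdct hJi) hlim⟩

/-- Integration by parts of the score against a linear functional. -/
lemma integral_score_mul_linear {V : E → ℝ} (hV : ContDiff ℝ 1 V) (v : E) (ℓ : E →L[ℝ] ℝ)
    (hint : Integrable (fun p => Real.exp (V p)) μ)
    (hℓ : Integrable (fun p => Real.exp (V p) * ℓ p ^ 2) μ)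
    (hJ : Integrable (fun p => Real.exp (V p) * fderiv ℝ V p v ^ 2) μ) :
    Integrable (fun p => Real.exp (V p) * (fderiv ℝ V p v * ℓ p)) μ ∧
      ∫ p, Real.exp (V p) * (fderiv ℝ V p v * ℓ p) ∂μ = -(ℓ v * ∫ p, Real.exp (V p) ∂μ) := by
  have hVd : Differentiable ℝ V := hV.differentiable (by norm_num)
  have hV1 : Continuous fun p => fderiv ℝ V p v :=
    ((hV.fderiv_right (m := 0) (by norm_num)).clm_apply contDiff_const).continuous
  have hexp : Continuous fun p => Real.exp (V p) := hV.continuous.rexp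
  have h1 : Integrable (fun p => Real.exp (V p) * (fderiv ℝ V p v * ℓ p)) μ := by
    refine (hℓ.add hJ).mono' (hexp.mul (hV1.mul ℓ.continuous)).aestronglyMeasurable
      (Eventually.of_forall fun p => ?_)
    rw [norm_mul, Real.norm_of_nonneg (Real.exp_pos _).le, Pi.add_apply, ← mul_add]
    refine mul_le_mul_of_nonneg_left ?_ (Real.exp_pos _).le
    rw [norm_mul, Real.norm_eq_abs, Real.norm_eq_abs, ← sq_abs (ℓ p), ← sq_abs (fderiv ℝ V p v)]
    nlinarith [sq_nonneg (|fderiv ℝ V p v| - |ℓ p|), sq_nonneg |fderiv ℝ V p v|, sq_nonneg |ℓ p|]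
  have h2 : Integrable (fun p => ℓ p * Real.exp (V p)) μ := by
    refine (hℓ.add hint).mono' (ℓ.continuous.mul hexp).aestronglyMeasurable
      (Eventually.of_forall fun p => ?_)
    rw [norm_mul, Real.norm_of_nonneg (Real.exp_pos _).le, Pi.add_apply, Real.norm_eq_abs]
    have := Real.exp_pos (V p)
    rw [← sq_abs (ℓ p)]
    nlinarith [mul_nonneg this.le (sq_nonneg (|ℓ p| - 1)), mul_nonneg this.le (sq_nonneg |ℓ p|)]
  have hue : ∀ p, fderiv ℝ (fun q => Real.exp (V q)) p v = Real.exp (V p) * fderiv ℝ V p v :=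
    fun p => fderiv_exp_apply hVd p v
  have hparts := integral_mul_fderiv_eq_neg_fderiv_mul_of_integrable (μ := μ) (f := fun p => ℓ p)
    (g := fun p => Real.exp (V p)) (v := v)
    (by simpa using hint.const_mul (ℓ v))
    (by
      simp_rw [hue]
      refine h1.congr (Eventually.of_forall fun p => ?_)
      simp only
      ring) h2 (fun p _ => ℓ.differentiableAt) (fun p _ => hVd.exp p)
  refine ⟨h1, ?_⟩
  simp_rw [hue, ContinuousLinearMap.fderiv, integral_const_mul] at hparts
  rw [← hparts]
  refine integral_congr_ae (Eventually.of_forall fun p => ?_)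
  simp only
  ring

end IntegrationByParts

/-! ### The Gaussian density on `ℝⁿ` -/

/-- The standard Gaussian density on `ℝⁿ`. -/
noncomputable def gaussDensity {n : ℕ} (p : Fin n → ℝ) : ℝ := ∏ i, φ (p i)

variable {n : ℕ}

lemma gaussDensity_pos (p : Fin n → ℝ) : 0 < gaussDensity p :=
  Finset.prod_pos fun i _ => gaussianPDFReal_std_pos (p i)

lemma continuous_gaussDensity : Continuous (gaussDensity (n := n)) :=
  continuous_finsetProd _ fun i _ => continuous_gaussianPDFReal_std.comp (continuous_apply i)

lemma log_gaussDensity (p : Fin n → ℝ) :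
    Real.log (gaussDensity p) = -(n / 2 * Real.log (2 * Real.pi)) - (∑ i, p i ^ 2) / 2 := by
  rw [gaussDensity, Real.log_prod fun i _ => (gaussianPDFReal_std_pos (p i)).ne']
  simp_rw [log_gaussianPDFReal_std]
  rw [Finset.sum_sub_distrib, ← Finset.sum_div]
  simp
  ring

lemma integrable_gaussDensity : Integrable (gaussDensity (n := n)) :=
  Integrable.fintype_prod (μ := fun _ => volume) fun _ => integrable_gaussianPDFReal 0 1

lemma integral_gaussDensity : ∫ p, gaussDensity (n := n) p = 1 := by
  have := integral_fintype_prod_volume_eq_prod (ι := Fin n) (fun _ => φ)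
  simpa [gaussDensity, integral_gaussianPDFReal_eq_one 0 one_ne_zero] using this

lemma pi_gaussianReal_eq_withDensity :
    (Measure.pi fun _ : Fin n => gaussianReal 0 1) =
      volume.withDensity fun p => ENNReal.ofReal (gaussDensity p) := by
  refine Measure.pi_eq fun s hs => ?_
  rw [withDensity_apply _ (MeasurableSet.univ_pi hs),
    ← ofReal_integral_eq_lintegral_ofReal integrable_gaussDensity.integrableOn
      (Eventually.of_forall fun p => (gaussDensity_pos p).le), volume_pi,
    Measure.restrict_pi_pi]
  have h := integral_fintype_prod_eq_prod (fun _ : Fin n => φ)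
    (μ := fun i => volume.restrict (s i))
  rw [show (fun p : Fin n → ℝ => gaussDensity p) = fun p => ∏ i, φ (p i) from rfl, h,
    ENNReal.ofReal_prod_of_nonneg fun i _ => integral_nonneg fun x => gaussianPDFReal_nonneg _ _ _]
  refine Finset.prod_congr rfl fun i _ => ?_
  rw [gaussianReal_apply_eq_integral 0 one_ne_zero]

lemma integrable_pi_gaussianReal_iff {h : (Fin n → ℝ) → ℝ} :
    Integrable h (Measure.pi fun _ => gaussianReal 0 1) ↔
      Integrable fun p => h p * gaussDensity p := by
  rw [pi_gaussianReal_eq_withDensity, integrable_withDensity_iff_integrable_smul'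
    continuous_gaussDensity.measurable.ennreal_ofReal
    (Eventually.of_forall fun _ => ENNReal.ofReal_lt_top)]
  simp [ENNReal.toReal_ofReal (gaussDensity_pos _).le, mul_comm]

lemma integral_pi_gaussianReal (h : (Fin n → ℝ) → ℝ) :
    ∫ p, h p ∂(Measure.pi fun _ => gaussianReal 0 1) = ∫ p, h p * gaussDensity p := by
  rw [pi_gaussianReal_eq_withDensity, integral_withDensity_eq_integral_toReal_smul
    continuous_gaussDensity.measurable.ennreal_ofReal
    (Eventually.of_forall fun _ => ENNReal.ofReal_lt_top)]
  simp [ENNReal.toReal_ofReal (gaussDensity_pos _).le, mul_comm]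

/-! ### The logarithmic Sobolev inequality for the Lebesgue measure -/

/-- The Gaussian logarithmic Sobolev inequality, written for the Lebesgue density `e^V`. -/
theorem integral_exp_mul_le_of_fisher {V : (Fin n → ℝ) → ℝ} (hV : ContDiff ℝ 1 V)
    (h1 : ∫ p, Real.exp (V p) = 1)
    (hsq : ∀ i, Integrable fun p => Real.exp (V p) * p i ^ 2)
    (hJ : ∀ i, Integrable fun p => Real.exp (V p) * fderiv ℝ V p (Pi.single i 1) ^ 2) :
    Integrable (fun p => Real.exp (V p) * V p) ∧
      ∫ p, Real.exp (V p) * V p ≤ -(n / 2 * Real.log (2 * Real.pi)) - n +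
        (∑ i, ∫ p, Real.exp (V p) * fderiv ℝ V p (Pi.single i 1) ^ 2) / 2 := by
  have hVd : Differentiable ℝ V := hV.differentiable (by norm_num)
  have hV1 : ∀ v, Continuous fun p => fderiv ℝ V p v := fun v =>
    ((hV.fderiv_right (m := 0) (by norm_num)).clm_apply contDiff_const).continuous
  have hint : Integrable fun p => Real.exp (V p) := integrable_of_integral_eq_one h1
  set L : (Fin n → ℝ) → ℝ := fun p => Real.log (gaussDensity p) with hL
  have hLi : Integrable fun p => Real.exp (V p) * L p := by
    have := (hint.mul_const (-(n / 2 * Real.log (2 * Real.pi)))).sub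
      ((integrable_finsetSum Finset.univ fun i _ => hsq i).div_const 2)
    refine this.congr (Eventually.of_forall fun p => ?_)
    simp only [hL, log_gaussDensity, Pi.sub_apply, ← Finset.mul_sum]
    ring
  have hLv : ∫ p, Real.exp (V p) * L p = -(n / 2 * Real.log (2 * Real.pi)) -
      (∑ i, ∫ p, Real.exp (V p) * p i ^ 2) / 2 := by
    rw [← integral_finsetSum _ fun i _ => hsq i, ← integral_div,
      ← one_mul (-(n / 2 * Real.log (2 * Real.pi))), ← h1, ← integral_mul_const,
      ← integral_sub (hint.mul_const _)
      ((integrable_finsetSum Finset.univ fun i _ => hsq i).div_const 2)]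
    refine integral_congr_ae (Eventually.of_forall fun p => ?_)
    simp only [hL, log_gaussDensity, ← Finset.mul_sum]
    ring
  -- the density with respect to the Gaussian measure and its partial derivatives
  set f : (Fin n → ℝ) → ℝ := fun p => Real.exp (V p) / gaussDensity p with hf
  set D : Fin n → (Fin n → ℝ) → ℝ :=
    fun i p => f p * (fderiv ℝ V p (Pi.single i 1) + p i) with hD
  have hfg : ∀ p, f p * gaussDensity p = Real.exp (V p) := fun p =>
    div_mul_cancel₀ _ (gaussDensity_pos p).ne'
  have hfpos : ∀ p, 0 < f p := fun p => div_pos (Real.exp_pos _) (gaussDensity_pos p)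
  have hfexp : f = fun p =>
      Real.exp (V p + (n / 2 * Real.log (2 * Real.pi) + (∑ i, p i ^ 2) / 2)) := by
    ext p
    rw [hf]
    simp only
    rw [← Real.exp_log (gaussDensity_pos p), ← Real.exp_sub, log_gaussDensity]
    congr 1
    ring
  have hlogf : ∀ p, Real.log (f p) = V p - L p := fun p => by
    rw [hf, hL]
    simp only
    rw [Real.log_div (Real.exp_ne_zero _) (gaussDensity_pos p).ne', Real.log_exp]
  have hfc : Continuous f := hV.continuous.rexp.div continuous_gaussDensity fun p =>
    (gaussDensity_pos p).ne'
  have hDc : ∀ i, Continuous (D i) := fun i =>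
    hfc.mul ((hV1 _).add (continuous_apply i))
  have hfD : ∀ i p, HasDerivAt (fun t => f (Function.update p i t)) (D i p) (p i) := by
    intro i p
    have hq : HasFDerivAt (fun p : Fin n → ℝ => ∑ i, p i ^ 2)
        (∑ j, (2 * p j) • (ContinuousLinearMap.proj j : (Fin n → ℝ) →L[ℝ] ℝ)) p := by
      refine HasFDerivAt.fun_sum fun j _ => ?_
      simpa using ((ContinuousLinearMap.proj j : (Fin n → ℝ) →L[ℝ] ℝ).hasFDerivAt (x := p)).pow 2
    have hW := ((hVd p).hasFDerivAt.add
      ((hq.mul_const (2⁻¹ : ℝ)).const_add (n / 2 * Real.log (2 * Real.pi)))).exp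
    have h := (HasFDerivAt.congr_of_eventuallyEq hW (f₁ := f) (Eventually.of_forall fun q => by
      rw [hfexp]; simp [div_eq_mul_inv]))
    rw [← Function.update_eq_self i p] at h
    refine (h.comp_hasDerivAt (p i) (hasDerivAt_update p i (p i))).congr_deriv ?_
    simp only [hD, hfexp]
    simp [div_eq_mul_inv, Pi.single_apply]
    ring
  have hgint : Integrable f (Measure.pi fun _ => gaussianReal 0 1) :=
    integrable_pi_gaussianReal_iff.2 (by simpa only [hfg] using hint)
  have hm : ∫ p, f p ∂(Measure.pi fun _ => gaussianReal 0 1) = 1 := by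
    rw [integral_pi_gaussianReal]
    simp only [hfg, h1]
  have hlsi := pi_gaussianReal_logSobolev hfpos hfc hDc hfD hgint
  -- the right-hand side is finite
  have hscore := fun i => integral_score_mul_linear (μ := volume) hV (Pi.single i 1)
    (ContinuousLinearMap.proj i : (Fin n → ℝ) →L[ℝ] ℝ) hint (hsq i) (hJ i)
  simp only [ContinuousLinearMap.proj_apply, Pi.single_eq_same, h1, mul_one] at hscore
  have hterm : ∀ i p, D i p ^ 2 / (2 * f p) * gaussDensity p =
      Real.exp (V p) * fderiv ℝ V p (Pi.single i 1) ^ 2 / 2 +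
        Real.exp (V p) * (fderiv ℝ V p (Pi.single i 1) * p i) + Real.exp (V p) * p i ^ 2 / 2 := by
    intro i p
    rw [hD, ← hfg p]
    have := (hfpos p).ne'
    field_simp
    ring
  have hDi : ∀ i, Integrable (fun p => D i p ^ 2 / (2 * f p) * gaussDensity p) := fun i => by
    simp_rw [hterm]
    exact (((hJ i).div_const 2).add (hscore i).1).add ((hsq i).div_const 2)
  have hDv : ∀ i, ∫ p, D i p ^ 2 / (2 * f p) * gaussDensity p =
      (∫ p, Real.exp (V p) * fderiv ℝ V p (Pi.single i 1) ^ 2) / 2 - 1 +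
        (∫ p, Real.exp (V p) * p i ^ 2) / 2 := fun i => by
    simp_rw [hterm]
    rw [integral_add (((hJ i).div_const 2).fun_add (hscore i).1) ((hsq i).div_const 2),
      integral_add ((hJ i).div_const 2) (hscore i).1, (hscore i).2, integral_div, integral_div]
    ring
  have hD0 : ∀ i p, 0 ≤ D i p ^ 2 / (2 * f p) := fun i p => by
    have := hfpos p
    positivity
  have hrhs : ∀ i, ∫⁻ p, ENNReal.ofReal (D i p ^ 2 / (2 * f p))
      ∂(Measure.pi fun _ => gaussianReal 0 1) =
        ENNReal.ofReal (∫ p, D i p ^ 2 / (2 * f p) * gaussDensity p) := fun i => by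
    rw [← integral_pi_gaussianReal, ofReal_integral_eq_lintegral_ofReal
      (integrable_pi_gaussianReal_iff.2 (hDi i)) (Eventually.of_forall (hD0 i))]
  simp_rw [hrhs] at hlsi
  rw [← ENNReal.ofReal_sum_of_nonneg fun i _ => integral_nonneg fun p =>
    mul_nonneg (hD0 i p) (gaussDensity_pos p).le, entropy, hm] at hlsi
  simp only [div_one] at hlsi
  set A : (Fin n → ℝ) → ℝ := fun p => f p * Real.log (f p) - f p + 1 with hA
  have hA0 : ∀ p, 0 ≤ A p := fun p => by
    simpa using mul_log_add_sub_le (hfpos p) one_pos one_pos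
  have hAc : Continuous A :=
    ((hfc.mul (hfc.log fun p => (hfpos p).ne')).sub hfc).add continuous_const
  have hAi : Integrable A (Measure.pi fun _ => gaussianReal 0 1) := by
    rw [← lintegral_ofReal_ne_top_iff_integrable hAc.aestronglyMeasurable
      (Eventually.of_forall hA0)]
    exact ne_top_of_le_ne_top ENNReal.ofReal_ne_top hlsi
  rw [← ofReal_integral_eq_lintegral_ofReal hAi (Eventually.of_forall hA0),
    ENNReal.ofReal_le_ofReal_iff (Finset.sum_nonneg fun i _ => integral_nonneg fun p =>
      mul_nonneg (hD0 i p) (gaussDensity_pos p).le), integral_pi_gaussianReal] at hlsi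
  have hAi' := integrable_pi_gaussianReal_iff.1 hAi
  have hAeq : ∀ p, Real.exp (V p) * V p =
      A p * gaussDensity p + (Real.exp (V p) * L p + (Real.exp (V p) - gaussDensity p)) := by
    intro p
    rw [hA]
    simp only
    rw [hlogf, ← hfg p]
    ring
  have hdiff : Integrable fun p => Real.exp (V p) - gaussDensity p :=
    hint.sub integrable_gaussDensity
  have hrest : Integrable fun p => Real.exp (V p) * L p + (Real.exp (V p) - gaussDensity p) :=
    hLi.add hdiff
  simp_rw [hAeq]
  refine ⟨hAi'.add hrest, ?_⟩
  rw [integral_add hAi' hrest, integral_add hLi hdiff,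
    integral_sub hint integrable_gaussDensity, h1, integral_gaussDensity, hLv]
  simp_rw [hDv, Finset.sum_add_distrib, Finset.sum_sub_distrib, ← Finset.sum_div] at hlsi
  simp at hlsi
  linarith

/-! ### Linear changes of variables and quadratic forms -/

open scoped MatrixOrder Matrix.Norms.L2Operator in
lemma exists_eq_conjTranspose_mul_self {M : Matrix (Fin n) (Fin n) ℝ} (hM : M.PosDef) :
    ∃ C : Matrix (Fin n) (Fin n) ℝ, M = C.conjTranspose * C := by
  refine ⟨CFC.sqrt M, ?_⟩
  have h := (Matrix.nonneg_iff_posSemidef.1 (CFC.sqrt_nonneg M)).isHermitian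
  rw [h.eq, CFC.sqrt_mul_sqrt_self M (Matrix.nonneg_iff_posSemidef.2 hM.posSemidef)]

/-- A positive definite quadratic form becomes the identity after a linear change of variables; the
Jacobian enters the entropy bounds through its logarithm. -/
lemma exists_transpose_mul_mul_eq_one {M : Matrix (Fin n) (Fin n) ℝ} (hM : M.PosDef) :
    ∃ B : Matrix (Fin n) (Fin n) ℝ, B.det ≠ 0 ∧ B.transpose * M * B = 1 ∧
      Real.log |B.det| = -(Real.log M.det / 2) := by
  obtain ⟨C, hC⟩ := exists_eq_conjTranspose_mul_self hM
  rw [Matrix.conjTranspose_eq_transpose_of_trivial] at hC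
  have hdet : M.det = C.det ^ 2 := by
    rw [hC, Matrix.det_mul, Matrix.det_transpose, sq]
  have hC0 : C.det ≠ 0 := fun h => hM.det_pos.ne' (by rw [hdet, h]; simp)
  have hu : IsUnit C.det := hC0.isUnit
  refine ⟨C⁻¹, ?_, ?_, ?_⟩
  · rw [Matrix.det_nonsing_inv, Ring.inverse_eq_inv']
    exact inv_ne_zero hC0
  · rw [hC, Matrix.transpose_nonsing_inv, Matrix.mul_assoc, Matrix.mul_assoc,
      Matrix.mul_nonsing_inv _ hu, Matrix.mul_one, Matrix.nonsing_inv_mul]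
    rwa [Matrix.det_transpose]
  · rw [Matrix.det_nonsing_inv, Ring.inverse_eq_inv', hdet, Real.log_abs, Real.log_inv,
      Real.log_pow]
    push_cast
    ring

/-- The trace of `Bᵀ M B`, expanded over the columns of `B`. -/
lemma sum_quadratic_form_columns {M B : Matrix (Fin n) (Fin n) ℝ}
    (hB : B.transpose * M * B = 1) :
    ∑ k, (fun i => B i k) ⬝ᵥ M.mulVec (fun i => B i k) = n := by
  have h : ∀ k, (fun i => B i k) ⬝ᵥ M.mulVec (fun i => B i k) = (B.transpose * M * B) k k := by
    intro k
    rw [Matrix.mul_assoc, Matrix.mul_apply]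
    rfl
  simp_rw [h, hB]
  simp

lemma measurableEmbedding_mulVec {B : Matrix (Fin n) (Fin n) ℝ} (hB : B.det ≠ 0) :
    MeasurableEmbedding B.mulVec := by
  have hu : IsUnit B.det := hB.isUnit
  have hc : ∀ A : Matrix (Fin n) (Fin n) ℝ, Continuous A.mulVec := fun A =>
    continuous_const.matrix_mulVec continuous_id
  let e : (Fin n → ℝ) ≃ₜ (Fin n → ℝ) :=
    { toFun := B.mulVec
      invFun := B⁻¹.mulVec
      left_inv := fun p => by
        rw [Matrix.mulVec_mulVec, Matrix.nonsing_inv_mul _ hu, Matrix.one_mulVec]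
      right_inv := fun p => by
        rw [Matrix.mulVec_mulVec, Matrix.mul_nonsing_inv _ hu, Matrix.one_mulVec]
      continuous_toFun := hc B
      continuous_invFun := hc B⁻¹ }
  exact e.measurableEmbedding

lemma map_mulVec_volume {B : Matrix (Fin n) (Fin n) ℝ} (hB : B.det ≠ 0) :
    (volume : Measure (Fin n → ℝ)).map B.mulVec = ENNReal.ofReal |B.det⁻¹| • volume :=
  Real.map_matrix_volume_pi_eq_smul_volume_pi hB

lemma integrable_comp_mulVec {B : Matrix (Fin n) (Fin n) ℝ} (hB : B.det ≠ 0)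
    {g : (Fin n → ℝ) → ℝ} (hg : Integrable g) : Integrable fun p => g (B.mulVec p) := by
  have h : Integrable g ((volume : Measure (Fin n → ℝ)).map B.mulVec) := by
    rw [map_mulVec_volume hB]
    exact hg.smul_measure ENNReal.ofReal_ne_top
  exact (measurableEmbedding_mulVec hB).integrable_map_iff.1 h

lemma integral_comp_mulVec {B : Matrix (Fin n) (Fin n) ℝ} (hB : B.det ≠ 0)
    (g : (Fin n → ℝ) → ℝ) : |B.det| * ∫ p, g (B.mulVec p) = ∫ p, g p := by
  rw [← (measurableEmbedding_mulVec hB).integral_map g, map_mulVec_volume hB,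
    integral_smul_measure, ENNReal.toReal_ofReal (abs_nonneg _), smul_eq_mul, ← mul_assoc,
    ← abs_mul, mul_inv_cancel₀ hB, abs_one, one_mul]

lemma integrable_mul_sum_sq {ρ : (Fin n → ℝ) → ℝ} (hρ : Continuous ρ) (hρ0 : ∀ p, 0 ≤ ρ p)
    (hsq : ∀ i, Integrable fun p => ρ p * p i ^ 2) (c : Fin n → ℝ) :
    Integrable fun p => ρ p * (∑ i, c i * p i) ^ 2 := by
  refine ((integrable_finsetSum Finset.univ fun i _ => hsq i).const_mul (∑ i, c i ^ 2)).mono'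
    (by fun_prop) (Eventually.of_forall fun p => ?_)
  rw [norm_mul, Real.norm_of_nonneg (hρ0 p), Real.norm_of_nonneg (sq_nonneg _), ← Finset.mul_sum]
  have := mul_le_mul_of_nonneg_left (Finset.sum_mul_sq_le_sq_mul_sq Finset.univ c p) (hρ0 p)
  linarith

lemma integral_quadratic_form {X : Type*} [MeasurableSpace X] {μ : Measure X}
    {K : Fin n → Fin n → X → ℝ} (hK : ∀ i j, Integrable (K i j) μ) (c : Fin n → ℝ) :
    Integrable (fun p => ∑ i, ∑ j, c i * c j * K i j p) μ ∧
      ∫ p, ∑ i, ∑ j, c i * c j * K i j p ∂μ =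
        c ⬝ᵥ (Matrix.of fun i j => ∫ p, K i j p ∂μ).mulVec c := by
  have h : ∀ i, Integrable (fun p => ∑ j, c i * c j * K i j p) μ := fun i =>
    integrable_finsetSum _ fun j _ => (hK i j).const_mul _
  refine ⟨integrable_finsetSum _ fun i _ => h i, ?_⟩
  rw [integral_finsetSum _ fun i _ => h i]
  simp_rw [integral_finsetSum _ fun j _ => (hK _ j).const_mul (c _ * c j), integral_const_mul,
    dotProduct, Matrix.mulVec, dotProduct, Finset.mul_sum, Matrix.of_apply]
  refine Finset.sum_congr rfl fun i _ => Finset.sum_congr rfl fun j _ => ?_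
  ring

/-! ### The upper entropy bound: entropy and Fisher information -/

lemma integrable_mul_hessian {V : (Fin n → ℝ) → ℝ} (v : Fin n → ℝ)
    (hH : ∀ i j, Integrable fun p => Real.exp (V p) *
      fderiv ℝ (fderiv ℝ V) p (Pi.single i 1) (Pi.single j 1)) :
    Integrable (fun p => Real.exp (V p) * fderiv ℝ (fderiv ℝ V) p v v) ∧
      ∫ p, Real.exp (V p) * fderiv ℝ (fderiv ℝ V) p v v =
        v ⬝ᵥ (Matrix.of fun i j => ∫ p, Real.exp (V p) *
          fderiv ℝ (fderiv ℝ V) p (Pi.single i 1) (Pi.single j 1)).mulVec v := by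
  have h : ∀ p, Real.exp (V p) * fderiv ℝ (fderiv ℝ V) p v v = ∑ i, ∑ j, v i * v j *
      (Real.exp (V p) * fderiv ℝ (fderiv ℝ V) p (Pi.single i 1) (Pi.single j 1)) := by
    intro p
    have hv : v = ∑ i, v i • (Pi.single i 1 : Fin n → ℝ) := by
      ext j
      simp [Finset.sum_apply, Pi.single_apply]
    conv_lhs => rw [hv]
    simp only [map_sum, map_smul, sum_apply, smul_apply, smul_eq_mul, Finset.mul_sum]
    rw [Finset.sum_comm]
    refine Finset.sum_congr rfl fun i _ => Finset.sum_congr rfl fun j _ => ?_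
    ring
  simp_rw [h]
  exact integral_quadratic_form hH v

/-- The matrix `M = -∫ e^V ∇²V` is the Fisher information matrix of the density `e^V`; it is
positive definite, and it bounds the entropy of `e^V` from above. -/
theorem fisher_posDef_and_entropy_le {V : (Fin n → ℝ) → ℝ} (hV : ContDiff ℝ 2 V)
    (h1 : ∫ p, Real.exp (V p) = 1) (hsq : ∀ i, Integrable fun p => Real.exp (V p) * p i ^ 2)
    (hH : ∀ i j, Integrable fun p => Real.exp (V p) *
      fderiv ℝ (fderiv ℝ V) p (Pi.single i 1) (Pi.single j 1))
    {M : Matrix (Fin n) (Fin n) ℝ} (hM : M = Matrix.of fun i j => -∫ p, Real.exp (V p) *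
      fderiv ℝ (fderiv ℝ V) p (Pi.single i 1) (Pi.single j 1)) :
    M.PosDef ∧ Integrable (fun p => Real.exp (V p) * V p) ∧
      ∫ p, Real.exp (V p) * V p ≤
        -(n / 2 * Real.log (2 * Real.pi)) - n / 2 + Real.log M.det / 2 := by
  have hint : Integrable fun p => Real.exp (V p) := integrable_of_integral_eq_one h1
  have hVd : Differentiable ℝ V := hV.differentiable (by norm_num)
  have hV1 : ContDiff ℝ 1 (fderiv ℝ V) := hV.fderiv_right (m := 1) (by norm_num)
  have hV1d : Differentiable ℝ (fderiv ℝ V) := hV1.differentiable (by norm_num)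
  have hdd : ∀ v p, fderiv ℝ (fun q => fderiv ℝ V q v) p v = fderiv ℝ (fderiv ℝ V) p v v := by
    intro v p
    rw [fderiv_clm_apply (hV1d p) (differentiableAt_const v)]
    simp
  have hneg : (Matrix.of fun i j => ∫ p, Real.exp (V p) *
      fderiv ℝ (fderiv ℝ V) p (Pi.single i 1) (Pi.single j 1)) = -M := by
    rw [hM]
    ext i j
    simp
  -- the Fisher information in the direction `v` is the value of the quadratic form of `M`
  have hJ : ∀ v, Integrable (fun p => Real.exp (V p) * fderiv ℝ V p v ^ 2) ∧
      ∫ p, Real.exp (V p) * fderiv ℝ V p v ^ 2 = v ⬝ᵥ M.mulVec v := by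
    intro v
    obtain ⟨ha, hb⟩ := integrable_mul_hessian v hH
    simp_rw [← hdd v] at ha hb
    obtain ⟨hc, hd⟩ := fisher_information_eq hV v hint ha
    refine ⟨hc, ?_⟩
    rw [hd, hb, hneg, Matrix.neg_mulVec, dotProduct_neg, neg_neg]
  have hpd : M.PosDef := by
    rw [Matrix.posDef_iff_dotProduct_mulVec]
    constructor
    · ext i j
      rw [Matrix.conjTranspose_apply, hM]
      simp only [Matrix.of_apply, star_trivial]
      congr 2
      ext p
      congr 1
      exact (hV.contDiffAt.isSymmSndFDerivAt (by simp)).eq _ _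
    · intro v hv
      rw [star_trivial, ← (hJ v).2]
      have hnn : ∀ p, 0 ≤ Real.exp (V p) * fderiv ℝ V p v ^ 2 := fun p => by positivity
      refine lt_of_le_of_ne (integral_nonneg hnn) fun h0 => hv ?_
      -- if the Fisher information vanishes then so does the correlation of the score with `v`
      have hae := (integral_eq_zero_iff_of_nonneg hnn (hJ v).1).1 h0.symm
      set ℓ : (Fin n → ℝ) →L[ℝ] ℝ :=
        ∑ i, v i • (ContinuousLinearMap.proj i : (Fin n → ℝ) →L[ℝ] ℝ) with hℓ
      have hℓa : ∀ p, ℓ p = ∑ i, v i * p i := fun p => by simp [hℓ]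
      have hscore := (integral_score_mul_linear (μ := volume) (hV.of_le (by norm_num)) v ℓ hint
        (by
          simp_rw [hℓa]
          exact integrable_mul_sum_sq hV.continuous.rexp (fun p => (Real.exp_pos _).le) hsq v)
        (hJ v).1).2
      have hzero : ∫ p, Real.exp (V p) * (fderiv ℝ V p v * ℓ p) = 0 := by
        rw [← integral_zero (Fin n → ℝ) ℝ (μ := volume)]
        refine integral_congr_ae ?_
        filter_upwards [hae] with p hp
        have : fderiv ℝ V p v = 0 := by simpa [(Real.exp_pos (V p)).ne'] using hp
        rw [this]
        simp
      rw [hzero, h1, mul_one, hℓa] at hscore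
      have hvv : v ⬝ᵥ v = 0 := by
        simp only [dotProduct]
        linarith
      exact dotProduct_self_eq_zero.1 hvv
  obtain ⟨B, hB0, hB1, hBlog⟩ := exists_transpose_mul_mul_eq_one hpd
  refine ⟨hpd, ?_⟩
  -- the linear change of variables which turns the Fisher information matrix into the identity
  set W : (Fin n → ℝ) → ℝ := fun p => V (B.mulVec p) + Real.log |B.det| with hW
  set Bl : (Fin n → ℝ) →L[ℝ] (Fin n → ℝ) := LinearMap.toContinuousLinearMap B.mulVecLin with hBl
  have hBla : ∀ p, Bl p = B.mulVec p := fun p => rfl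
  have hexpW : ∀ p, Real.exp (W p) = |B.det| * Real.exp (V (B.mulVec p)) := fun p => by
    rw [hW, Real.exp_add, Real.exp_log (abs_pos.2 hB0), mul_comm]
  have hWc : ContDiff ℝ 1 W := by
    have : ContDiff ℝ 1 fun p => V (Bl p) := (hV.of_le (by norm_num)).comp Bl.contDiff
    exact this.add contDiff_const
  have hWd : ∀ p v, fderiv ℝ W p v = fderiv ℝ V (B.mulVec p) (B.mulVec v) := by
    intro p v
    have h : HasFDerivAt W ((fderiv ℝ V (Bl p)).comp Bl) p :=
      ((hVd (Bl p)).hasFDerivAt.comp p Bl.hasFDerivAt).add_const _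
    rw [h.fderiv]
    rfl
  have hcv : ∀ g : (Fin n → ℝ) → ℝ, Integrable (fun p => Real.exp (V p) * g p) →
      Integrable (fun p => Real.exp (W p) * g (B.mulVec p)) ∧
        ∫ p, Real.exp (W p) * g (B.mulVec p) = ∫ p, Real.exp (V p) * g p := by
    intro g hg
    simp_rw [hexpW, mul_assoc]
    refine ⟨(integrable_comp_mulVec hB0 hg).const_mul _, ?_⟩
    rw [integral_const_mul, integral_comp_mulVec hB0 fun p => Real.exp (V p) * g p]
  have hcol : ∀ k, B.mulVec (Pi.single k 1) = fun i => B i k := fun k => by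
    ext i
    simp
  have hW1 : ∫ p, Real.exp (W p) = 1 := by
    have := (hcv (fun _ => 1) (by simpa using hint)).2
    simpa [h1] using this
  have hWsq : ∀ i, Integrable fun p => Real.exp (W p) * p i ^ 2 := by
    intro i
    have := (hcv (fun q => (∑ j, B⁻¹ i j * q j) ^ 2)
      (integrable_mul_sum_sq hV.continuous.rexp (fun p => (Real.exp_pos _).le) hsq _)).1
    refine this.congr (Eventually.of_forall fun p => ?_)
    have hp : ∑ j, B⁻¹ i j * (B.mulVec p) j = p i := by
      change B⁻¹.mulVec (B.mulVec p) i = p i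
      rw [Matrix.mulVec_mulVec, Matrix.nonsing_inv_mul _ hB0.isUnit, Matrix.one_mulVec]
    simp only [hp]
  have hWJ : ∀ k, Integrable (fun p => Real.exp (W p) * fderiv ℝ W p (Pi.single k 1) ^ 2) ∧
      ∫ p, Real.exp (W p) * fderiv ℝ W p (Pi.single k 1) ^ 2 =
        (fun i => B i k) ⬝ᵥ M.mulVec (fun i => B i k) := by
    intro k
    simp_rw [hWd, hcol]
    rw [← (hJ _).2]
    exact hcv (fun q => fderiv ℝ V q (fun i => B i k) ^ 2) (hJ _).1
  obtain ⟨hWi, hWle⟩ := integral_exp_mul_le_of_fisher hWc hW1 hWsq fun k => (hWJ k).1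
  simp_rw [fun k => (hWJ k).2, sum_quadratic_form_columns hB1] at hWle
  have hVi : Integrable fun p => Real.exp (V p) * V p := by
    have h2 : Integrable fun p => Real.exp (W p) * V (B.mulVec p) := by
      refine (hWi.sub ((integrable_of_integral_eq_one hW1).mul_const (Real.log |B.det|))).congr
        (Eventually.of_forall fun p => ?_)
      simp only [hW, Pi.sub_apply]
      ring
    have h3 := integrable_comp_mulVec (B := B⁻¹)
      (by rw [Matrix.det_nonsing_inv, Ring.inverse_eq_inv']; exact inv_ne_zero hB0) h2
    have hinv : ∀ p, B.mulVec (B⁻¹.mulVec p) = p := fun p => by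
      rw [Matrix.mulVec_mulVec, Matrix.mul_nonsing_inv _ hB0.isUnit, Matrix.one_mulVec]
    simp_rw [hexpW, hinv] at h3
    refine (h3.const_mul |B.det|⁻¹).congr (Eventually.of_forall fun p => ?_)
    have := abs_ne_zero.2 hB0
    field_simp
  refine ⟨hVi, ?_⟩
  have hVW : ∫ p, Real.exp (W p) * W p = (∫ p, Real.exp (V p) * V p) + Real.log |B.det| := by
    obtain ⟨ha, hb⟩ := hcv V hVi
    have hc : ∀ p, Real.exp (W p) * W p =
        Real.exp (W p) * V (B.mulVec p) + Real.exp (W p) * Real.log |B.det| := fun p => by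
      simp only [hW]
      ring
    simp_rw [hc]
    rw [integral_add ha ((integrable_of_integral_eq_one hW1).mul_const _), hb,
      integral_mul_const, hW1, one_mul]
  rw [hVW, hBlog] at hWle
  linarith

/-! ### The lower entropy bound: Gaussian densities maximize the entropy -/

lemma integrable_mul_coord {ρ : (Fin n → ℝ) → ℝ} (hρ : Continuous ρ) (hρ0 : ∀ p, 0 ≤ ρ p)
    (hint : Integrable ρ) (hsq : ∀ i, Integrable fun p => ρ p * p i ^ 2) (i : Fin n) :
    Integrable fun p => ρ p * p i := by
  refine (hint.add (hsq i)).mono' (by fun_prop) (Eventually.of_forall fun p => ?_)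
  rw [norm_mul, Real.norm_of_nonneg (hρ0 p), Pi.add_apply, Real.norm_eq_abs, ← sq_abs (p i)]
  nlinarith [mul_nonneg (hρ0 p) (sq_nonneg (|p i| - 1)), mul_nonneg (hρ0 p) (sq_nonneg |p i|)]

lemma integrable_mul_coord_mul_coord {ρ : (Fin n → ℝ) → ℝ} (hρ : Continuous ρ)
    (hρ0 : ∀ p, 0 ≤ ρ p) (hsq : ∀ i, Integrable fun p => ρ p * p i ^ 2) (i j : Fin n) :
    Integrable fun p => ρ p * (p i * p j) := by
  refine ((hsq i).add (hsq j)).mono' (by fun_prop) (Eventually.of_forall fun p => ?_)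
  rw [norm_mul, Real.norm_of_nonneg (hρ0 p), Pi.add_apply, ← mul_add]
  refine mul_le_mul_of_nonneg_left ?_ (hρ0 p)
  rw [norm_mul, Real.norm_eq_abs, Real.norm_eq_abs, ← sq_abs (p i), ← sq_abs (p j)]
  nlinarith [sq_nonneg (|p i| - |p j|), sq_nonneg |p i|, sq_nonneg |p j|]

/-- The covariance matrix of a positive continuous density is positive definite, and it bounds the
entropy of the density from below. -/
theorem covariance_posDef_and_le_entropy {ρ : (Fin n → ℝ) → ℝ} (hρ : Continuous ρ)
    (hpos : ∀ p, 0 < ρ p) (h1 : ∫ p, ρ p = 1) (hsq : ∀ i, Integrable fun p => ρ p * p i ^ 2)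
    {C : Matrix (Fin n) (Fin n) ℝ} (hC : C = Matrix.of fun i j =>
      (∫ p, ρ p * (p i * p j)) - (∫ p, ρ p * p i) * ∫ p, ρ p * p j) :
    C.PosDef ∧ (Integrable (fun p => ρ p * Real.log (ρ p)) →
      -(n / 2 * Real.log (2 * Real.pi)) - n / 2 - Real.log C.det / 2 ≤
        ∫ p, ρ p * Real.log (ρ p)) := by
  have hint : Integrable ρ := integrable_of_integral_eq_one h1
  have hρ0 : ∀ p, 0 ≤ ρ p := fun p => (hpos p).le
  have hi1 := integrable_mul_coord hρ hρ0 hint hsq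
  have hi2 := integrable_mul_coord_mul_coord hρ hρ0 hsq
  set b : Fin n → ℝ := fun i => ∫ p, ρ p * p i with hb
  set K : Fin n → Fin n → (Fin n → ℝ) → ℝ := fun i j p =>
    ρ p * ((p i - b i) * (p j - b j)) with hK
  have hKeq : ∀ i j p, K i j p =
      ρ p * (p i * p j) - (ρ p * p i) * b j - ((ρ p * p j) * b i - ρ p * (b i * b j)) := by
    intro i j p
    simp only [hK]
    ring
  have hA : ∀ i j, Integrable fun p => ρ p * (p i * p j) - (ρ p * p i) * b j := fun i j =>
    (hi2 i j).sub ((hi1 i).mul_const _)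
  have hA' : ∀ i j, Integrable fun p => (ρ p * p j) * b i - ρ p * (b i * b j) := fun i j =>
    ((hi1 j).mul_const _).sub (hint.mul_const _)
  have hKi : ∀ i j, Integrable (K i j) := fun i j => by
    rw [show K i j = _ from funext (hKeq i j)]
    exact (hA i j).sub (hA' i j)
  have hKv : (Matrix.of fun i j => ∫ p, K i j p) = C := by
    rw [hC]
    ext i j
    simp only [Matrix.of_apply, hKeq]
    rw [integral_sub (hA i j) (hA' i j),
      integral_sub (hi2 i j) ((hi1 i).mul_const _),
      integral_sub ((hi1 j).mul_const _) (hint.mul_const _), integral_mul_const,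
      integral_mul_const, integral_mul_const, h1]
    simp only [hb]
    ring
  -- the quadratic form of the covariance matrix is the variance of a linear functional
  have hq : ∀ c : Fin n → ℝ, Integrable (fun p => ρ p * (∑ i, c i * (p i - b i)) ^ 2) ∧
      ∫ p, ρ p * (∑ i, c i * (p i - b i)) ^ 2 = c ⬝ᵥ C.mulVec c := by
    intro c
    have hexp : ∀ p, ρ p * (∑ i, c i * (p i - b i)) ^ 2 = ∑ i, ∑ j, c i * c j * K i j p := by
      intro p
      rw [sq, Finset.sum_mul_sum, Finset.mul_sum]
      refine Finset.sum_congr rfl fun i _ => ?_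
      rw [Finset.mul_sum]
      refine Finset.sum_congr rfl fun j _ => ?_
      simp only [hK]
      ring
    simp_rw [hexp]
    rw [← hKv]
    exact integral_quadratic_form hKi c
  have hpd : C.PosDef := by
    rw [Matrix.posDef_iff_dotProduct_mulVec]
    constructor
    · ext i j
      rw [Matrix.conjTranspose_apply, hC]
      simp only [Matrix.of_apply, star_trivial, mul_comm]
    · intro v hv
      rw [star_trivial, ← (hq v).2]
      have hnn : ∀ p, 0 ≤ ρ p * (∑ i, v i * (p i - b i)) ^ 2 := fun p =>
        mul_nonneg (hρ0 p) (sq_nonneg _)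
      refine lt_of_le_of_ne (integral_nonneg hnn) fun h0 => hv ?_
      have hae := (integral_eq_zero_iff_of_nonneg hnn (hq v).1).1 h0.symm
      have hall := (Continuous.ae_eq_iff_eq volume (by fun_prop) continuous_const).1 hae
      have hp := congrFun hall (fun i => b i + v i)
      simp only [add_sub_cancel_left] at hp
      exact dotProduct_self_eq_zero.1
        (pow_eq_zero_iff two_ne_zero |>.1 ((mul_eq_zero.1 hp).resolve_left (hpos _).ne'))
  refine ⟨hpd, fun hlogi => ?_⟩
  obtain ⟨B, hB0, hB1, hBlog⟩ := exists_transpose_mul_mul_eq_one hpd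
  have hBt0 : B.transpose.det ≠ 0 := by rwa [Matrix.det_transpose]
  -- the Gaussian density with the same mean and covariance
  set q : (Fin n → ℝ) → ℝ := fun p => |B.det| * gaussDensity (B.transpose.mulVec (p - b)) with hq'
  have hqpos : ∀ p, 0 < q p := fun p => mul_pos (abs_pos.2 hB0) (gaussDensity_pos _)
  have hqi : Integrable q :=
    ((integrable_comp_mulVec hBt0 integrable_gaussDensity).comp_sub_right b).const_mul _
  have hq1 : ∫ p, q p = 1 := by
    rw [hq', integral_const_mul,
      integral_sub_right_eq_self (fun p => gaussDensity (B.transpose.mulVec p)) b,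
      ← Matrix.det_transpose, integral_comp_mulVec hBt0, integral_gaussDensity]
  have hlogq : ∀ p, ρ p * Real.log (q p) =
      ρ p * (Real.log |B.det| - n / 2 * Real.log (2 * Real.pi)) -
        (∑ k, ρ p * (∑ i, B i k * (p i - b i)) ^ 2) / 2 := by
    intro p
    rw [hq', Real.log_mul (abs_ne_zero.2 hB0) (gaussDensity_pos _).ne', log_gaussDensity,
      ← Finset.mul_sum]
    have : ∀ k, B.transpose.mulVec (p - b) k = ∑ i, B i k * (p i - b i) := fun k => rfl
    simp_rw [this]
    ring
  have hqs : Integrable fun p => ∑ k, ρ p * (∑ i, B i k * (p i - b i)) ^ 2 :=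
    integrable_finsetSum _ fun k _ => (hq _).1
  have hlogqi : Integrable fun p => ρ p * Real.log (q p) := by
    simp_rw [hlogq]
    exact (hint.mul_const _).sub (hqs.div_const 2)
  have hlogqv : ∫ p, ρ p * Real.log (q p) =
      Real.log |B.det| - n / 2 * Real.log (2 * Real.pi) - n / 2 := by
    simp_rw [hlogq]
    rw [integral_sub (hint.mul_const _) (hqs.div_const 2), integral_mul_const, h1, one_mul,
      integral_div, integral_finsetSum _ fun k _ => (hq _).1]
    simp_rw [fun k => (hq fun i => B i k).2]
    rw [sum_quadratic_form_columns hB1]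
  have hdiff : Integrable fun p => ρ p - q p := hint.sub hqi
  -- Gibbs' inequality
  have hgibbs : ∫ p, (ρ p * Real.log (q p) + (ρ p - q p)) ≤ ∫ p, ρ p * Real.log (ρ p) := by
    refine integral_mono (hlogqi.add hdiff) hlogi fun p => ?_
    have h := mul_log_add_sub_le (hpos p) (hqpos p) one_pos
    rw [Real.log_div (hpos p).ne' (hqpos p).ne'] at h
    simp only [Real.log_one, mul_zero, mul_one] at h
    simp only
    linarith
  rw [integral_add hlogqi hdiff, integral_sub hint hqi, hlogqv, h1, hq1, hBlog] at hgibbs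
  linarith

/-! ### Differentiating exponential integrals -/

section ExpIntegral

variable {X E F : Type*} [NormedAddCommGroup E] [InnerProductSpace ℝ E] [NormedAddCommGroup F]
  [NormedSpace ℝ F]

/-- The weight produced by one differentiation of `k ↦ ∫ e^⟪Y p, k⟫ ψ p`. -/
noncomputable def derivWeight (Y : X → E) (ψ : X → F) (p : X) : E →L[ℝ] F :=
  (innerSL ℝ (Y p)).smulRight (ψ p)

lemma norm_derivWeight (Y : X → E) (ψ : X → F) (p : X) :
    ‖derivWeight Y ψ p‖ = ‖Y p‖ * ‖ψ p‖ := by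
  rw [derivWeight, ContinuousLinearMap.norm_smulRight_apply, innerSL_apply_norm]

lemma exp_inner_le {r : ℝ} {y k : E} (hk : ‖k‖ ≤ r) :
    Real.exp (inner ℝ y k) ≤ Real.exp (r * ‖y‖) := by
  refine Real.exp_le_exp.2 ((real_inner_le_norm y k).trans ?_)
  rw [mul_comm]
  gcongr

variable [MeasurableSpace X] {μ : Measure X} [FiniteDimensional ℝ E] [MeasurableSpace E]
  [BorelSpace E]

lemma aestronglyMeasurable_derivWeight {Y : X → E} (hY : Measurable Y) {ψ : X → F}
    (hψ : AEStronglyMeasurable ψ μ) : AEStronglyMeasurable (derivWeight Y ψ) μ := by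
  have h : Continuous fun q : E × F => (innerSL ℝ q.1).smulRight q.2 :=
    (ContinuousLinearMap.smulRightL ℝ E F).continuous₂.comp
      (((innerSL ℝ (E := E)).continuous.comp continuous_fst).prodMk continuous_snd)
  exact h.comp_aestronglyMeasurable (hY.aestronglyMeasurable.prodMk hψ)

lemma integrable_derivWeight {Y : X → E} (hY : Measurable Y) {ψ : X → F} {r s : ℝ} (hsr : s < r)
    (hψ : AEStronglyMeasurable ψ μ)
    (hint : Integrable (fun p => Real.exp (r * ‖Y p‖) * ‖ψ p‖) μ) :
    Integrable (fun p => Real.exp (s * ‖Y p‖) * ‖derivWeight Y ψ p‖) μ := by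
  refine (hint.const_mul (r - s)⁻¹).mono'
    (((hY.norm.const_mul s).exp.aestronglyMeasurable).mul
      (aestronglyMeasurable_derivWeight hY hψ).norm) (Eventually.of_forall fun p => ?_)
  rw [norm_mul, Real.norm_of_nonneg (Real.exp_pos _).le, norm_norm, norm_derivWeight]
  have hpos : 0 < r - s := sub_pos.2 hsr
  have h1 : ‖Y p‖ ≤ (r - s)⁻¹ * Real.exp ((r - s) * ‖Y p‖) := by
    rw [le_inv_mul_iff₀ hpos]
    linarith [Real.add_one_le_exp ((r - s) * ‖Y p‖)]
  calc Real.exp (s * ‖Y p‖) * (‖Y p‖ * ‖ψ p‖)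
      ≤ Real.exp (s * ‖Y p‖) * (((r - s)⁻¹ * Real.exp ((r - s) * ‖Y p‖)) * ‖ψ p‖) := by gcongr
    _ = (r - s)⁻¹ * (Real.exp (s * ‖Y p‖ + (r - s) * ‖Y p‖) * ‖ψ p‖) := by
        rw [Real.exp_add]
        ring
    _ = (r - s)⁻¹ * (Real.exp (r * ‖Y p‖) * ‖ψ p‖) := by
        congr 3
        ring

lemma aestronglyMeasurable_exp_inner_smul {Y : X → E} (hY : Measurable Y) {ψ : X → F}
    (hψ : AEStronglyMeasurable ψ μ) (k : E) :
    AEStronglyMeasurable (fun p => Real.exp (inner ℝ (Y p) k) • ψ p) μ :=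
  (Measurable.aestronglyMeasurable (by fun_prop)).smul hψ

lemma hasFDerivAt_integral_exp_inner {Y : X → E} (hY : Measurable Y) {ψ : X → F} {r : ℝ}
    (hψ : AEStronglyMeasurable ψ μ)
    (hint : Integrable (fun p => Real.exp (r * ‖Y p‖) * ‖ψ p‖) μ) {k : E} (hk : ‖k‖ < r) :
    HasFDerivAt (fun k => ∫ p, Real.exp (inner ℝ (Y p) k) • ψ p ∂μ)
      (∫ p, Real.exp (inner ℝ (Y p) k) • derivWeight Y ψ p ∂μ) k := by
  obtain ⟨s, hks, hsr⟩ := exists_between hk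
  refine hasFDerivAt_integral_of_dominated_of_fderiv_le
    (F' := fun k p => Real.exp (inner ℝ (Y p) k) • derivWeight Y ψ p)
    (Metric.ball_mem_nhds k (sub_pos.2 hks))
    (Eventually.of_forall fun k => aestronglyMeasurable_exp_inner_smul hY hψ k) ?_
    (aestronglyMeasurable_exp_inner_smul hY (aestronglyMeasurable_derivWeight hY hψ) k)
    (bound := fun p => Real.exp (s * ‖Y p‖) * ‖derivWeight Y ψ p‖) ?_
    (integrable_derivWeight hY hsr hψ hint) ?_
  · refine hint.mono' (aestronglyMeasurable_exp_inner_smul hY hψ k)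
      (Eventually.of_forall fun p => ?_)
    rw [norm_smul, Real.norm_of_nonneg (Real.exp_pos _).le]
    exact mul_le_mul_of_nonneg_right (exp_inner_le hk.le) (norm_nonneg _)
  · refine Eventually.of_forall fun p q hq => ?_
    rw [norm_smul, Real.norm_of_nonneg (Real.exp_pos _).le]
    refine mul_le_mul_of_nonneg_right (exp_inner_le ?_) (norm_nonneg _)
    have h1 := norm_le_norm_add_norm_sub' q k
    have h2 : ‖q - k‖ < s - ‖k‖ := mem_ball_iff_norm.1 hq
    linarith
  · refine Eventually.of_forall fun p q _ => ?_
    have h1 : HasFDerivAt (fun k : E => inner ℝ (Y p) k) (innerSL ℝ (Y p)) q :=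
      (innerSL ℝ (Y p)).hasFDerivAt
    refine (h1.exp.smul_const (ψ p)).congr_fderiv ?_
    ext v
    simp [derivWeight, mul_smul]

/-- Exponential integrals are twice continuously differentiable at the origin, with the derivatives
obtained by differentiating under the integral sign. -/
lemma exp_integral_second_order {Y : X → E} (hY : Measurable Y) {ψ : X → ℝ} {r : ℝ} (hr : 0 < r)
    (hψ : AEStronglyMeasurable ψ μ)
    (hint : Integrable (fun p => Real.exp (r * ‖Y p‖) * ‖ψ p‖) μ) :
    ContDiffAt ℝ 2 (fun k => ∫ p, Real.exp (inner ℝ (Y p) k) * ψ p ∂μ) 0 ∧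
    (∀ v, fderiv ℝ (fun k => ∫ p, Real.exp (inner ℝ (Y p) k) * ψ p ∂μ) 0 v =
      ∫ p, inner ℝ (Y p) v * ψ p ∂μ) ∧
    ∀ v w, fderiv ℝ (fderiv ℝ (fun k => ∫ p, Real.exp (inner ℝ (Y p) k) * ψ p ∂μ)) 0 v w =
      ∫ p, inner ℝ (Y p) v * inner ℝ (Y p) w * ψ p ∂μ := by
  have hψ1 := aestronglyMeasurable_derivWeight hY hψ
  have hψ2 := aestronglyMeasurable_derivWeight hY hψ1
  have hr2 : 0 < r / 2 := by linarith
  have hr3 : 0 < r / 3 := by linarith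
  have hi1 := integrable_derivWeight hY (by linarith : r / 2 < r) hψ hint
  have hi2 := integrable_derivWeight hY (by linarith : r / 3 < r / 2) hψ1 hi1
  set Λ : E → ℝ := fun k => ∫ p, Real.exp (inner ℝ (Y p) k) * ψ p ∂μ with hΛ
  set Λ1 : E → E →L[ℝ] ℝ := fun k => ∫ p, Real.exp (inner ℝ (Y p) k) • derivWeight Y ψ p ∂μ
  set Λ2 : E → E →L[ℝ] E →L[ℝ] ℝ :=
    fun k => ∫ p, Real.exp (inner ℝ (Y p) k) • derivWeight Y (derivWeight Y ψ) p ∂μ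
  have hd0 : ∀ k, ‖k‖ < r → HasFDerivAt Λ (Λ1 k) k := fun k hk =>
    hasFDerivAt_integral_exp_inner hY hψ hint hk
  have hd1 : ∀ k, ‖k‖ < r / 2 → HasFDerivAt Λ1 (Λ2 k) k := fun k hk =>
    hasFDerivAt_integral_exp_inner hY hψ1 hi1 hk
  have hball : ∀ {s : ℝ}, 0 < s → {k : E | ‖k‖ < s} ∈ 𝓝 (0 : E) := fun hs =>
    (continuous_norm.isOpen_preimage _ isOpen_Iio).mem_nhds (by simpa using hs)
  have hc2 : ContDiffAt ℝ 0 Λ2 0 := by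
    rw [contDiffAt_zero]
    exact ⟨_, hball hr3, fun k hk =>
      (hasFDerivAt_integral_exp_inner hY hψ2 hi2 hk).continuousAt.continuousWithinAt⟩
  have hc1 : ContDiffAt ℝ 1 Λ1 0 := by
    have := (contDiffAt_succ_iff_hasFDerivAt (n := 0) (f := Λ1) (x := 0) (𝕜 := ℝ)).2
      ⟨Λ2, ⟨_, hball hr2, fun k hk => hd1 k hk⟩, by exact_mod_cast hc2⟩
    exact_mod_cast this
  have hc0 : ContDiffAt ℝ 2 Λ 0 := by
    have := (contDiffAt_succ_iff_hasFDerivAt (n := 1) (f := Λ) (x := 0) (𝕜 := ℝ)).2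
      ⟨Λ1, ⟨_, hball hr, fun k hk => hd0 k hk⟩, by exact_mod_cast hc1⟩
    exact_mod_cast this
  have hfd : fderiv ℝ Λ =ᶠ[𝓝 0] Λ1 := by
    filter_upwards [hball hr] with k hk
    exact (hd0 k hk).fderiv
  have hn : ‖(0 : E)‖ < r / 3 := by simpa using hr3
  have hΛ1i : Integrable (fun p => Real.exp (inner ℝ (Y p) 0) • derivWeight Y ψ p) μ :=
    hi1.mono' (aestronglyMeasurable_exp_inner_smul hY hψ1 0) (Eventually.of_forall fun p => by
      rw [norm_smul, Real.norm_of_nonneg (Real.exp_pos _).le]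
      exact mul_le_mul_of_nonneg_right (exp_inner_le (by linarith)) (norm_nonneg _))
  have hΛ2i : Integrable (fun p => Real.exp (inner ℝ (Y p) 0) •
      derivWeight Y (derivWeight Y ψ) p) μ :=
    hi2.mono' (aestronglyMeasurable_exp_inner_smul hY hψ2 0) (Eventually.of_forall fun p => by
      rw [norm_smul, Real.norm_of_nonneg (Real.exp_pos _).le]
      exact mul_le_mul_of_nonneg_right (exp_inner_le hn.le) (norm_nonneg _))
  refine ⟨hc0, fun v => ?_, fun v w => ?_⟩
  · rw [hfd.self_of_nhds, ContinuousLinearMap.integral_apply hΛ1i]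
    simp [derivWeight]
  · rw [hfd.fderiv_eq, (hd1 0 (by linarith)).fderiv, ContinuousLinearMap.integral_apply hΛ2i,
      ContinuousLinearMap.integral_apply (hΛ2i.apply_continuousLinearMap v)]
    refine integral_congr_ae (Eventually.of_forall fun p => ?_)
    simp [derivWeight]
    ring

end ExpIntegral

/-! ### Second derivatives of exponentials, logarithms and rescaled functions -/

section SecondDerivatives

variable {E : Type*} [NormedAddCommGroup E] [NormedSpace ℝ E]

lemma fderiv_comp_smul_sub {G : Type*} [NormedAddCommGroup G] [NormedSpace ℝ G] (F : E → G)
    (c : ℝ) (x y : E) :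
    fderiv ℝ (fun y => F (c • (y - x))) y = c • fderiv ℝ F (c • (y - x)) := by
  have h := fderiv_comp_sub (𝕜 := ℝ) (f := fun z => F (c • z)) (x := y) x
  rw [h, fderiv_comp_smul]

lemma fderiv_fderiv_comp_smul_sub (F : E → ℝ) (c : ℝ) (x y v w : E) :
    fderiv ℝ (fderiv ℝ fun y => F (c • (y - x))) y v w =
      c ^ 2 * fderiv ℝ (fderiv ℝ F) (c • (y - x)) v w := by
  have h : fderiv ℝ (fun y => F (c • (y - x))) = fun y => (c • fderiv ℝ F) (c • (y - x)) :=
    funext fun y => fderiv_comp_smul_sub F c x y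
  have h2 : fderiv ℝ (c • fderiv ℝ F) = c • fderiv ℝ (fderiv ℝ F) :=
    fderiv_const_smul_field (𝕜 := ℝ) (R := ℝ) (f := fderiv ℝ F) c
  rw [h, fderiv_comp_smul_sub (c • fderiv ℝ F), h2]
  simp [sq, mul_assoc]

lemma fderiv_fderiv_exp {u : E → ℝ} {x : E} (hu : ContDiffAt ℝ 2 u x) (v w : E) :
    fderiv ℝ (fderiv ℝ fun y => Real.exp (u y)) x v w =
      Real.exp (u x) * (fderiv ℝ (fderiv ℝ u) x v w + fderiv ℝ u x v * fderiv ℝ u x w) := by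
  have h1 : ∀ᶠ y in 𝓝 x, DifferentiableAt ℝ u y :=
    (hu.eventually (by simp)).mono fun y hy => hy.differentiableAt (by norm_num)
  have h2 : fderiv ℝ (fun y => Real.exp (u y)) =ᶠ[𝓝 x] fun y => Real.exp (u y) • fderiv ℝ u y :=
    h1.mono fun y hy => fderiv_exp hy
  have h3 : DifferentiableAt ℝ (fderiv ℝ u) x :=
    (hu.fderiv_right (m := 1) (by norm_num)).differentiableAt (by norm_num)
  rw [h2.fderiv_eq, fderiv_fun_smul h1.self_of_nhds.exp h3, fderiv_exp h1.self_of_nhds]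
  simp
  ring

lemma fderiv_fderiv_log {u : E → ℝ} {x : E} (hu : ContDiffAt ℝ 2 u x) (hx : 0 < u x) (v w : E) :
    fderiv ℝ (fderiv ℝ fun y => Real.log (u y)) x v w =
      fderiv ℝ (fderiv ℝ u) x v w / u x - fderiv ℝ u x v * fderiv ℝ u x w / u x ^ 2 := by
  have hne : ∀ᶠ y in 𝓝 x, u y ≠ 0 := hu.continuousAt.eventually_ne hx.ne'
  have hlog : ContDiffAt ℝ 2 (fun y => Real.log (u y)) x := hu.log hx.ne'
  have hexp : (fun y => Real.exp (Real.log (u y))) =ᶠ[𝓝 x] u := by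
    filter_upwards [hu.continuousAt.eventually (lt_mem_nhds hx)] with y hy
    exact Real.exp_log hy
  have h := fderiv_fderiv_exp hlog v w
  rw [hexp.fderiv.fderiv_eq, Real.exp_log hx, fderiv.log (hu.differentiableAt (by norm_num)) hx.ne']
    at h
  simp only [smul_apply, smul_eq_mul] at h
  rw [h]
  field_simp
  ring

end SecondDerivatives

/-! ### The heat semigroup in Gaussian coordinates -/

lemma measurableEmbedding_add_sqrt_smul {T : ℝ} (hT : 0 < T) (x : EuclideanSpace ℝ (Fin n)) :
    MeasurableEmbedding fun p : Fin n → ℝ => x + Real.sqrt T • WithLp.toLp 2 p := by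
  have hs : Real.sqrt T ≠ 0 := (Real.sqrt_pos.2 hT).ne'
  have h2 : MeasurableEmbedding fun z : EuclideanSpace ℝ (Fin n) => x + Real.sqrt T • z :=
    ((Homeomorph.smulOfNeZero _ hs).trans (Homeomorph.addLeft x)).measurableEmbedding
  exact h2.comp (MeasurableEquiv.toLp 2 (Fin n → ℝ)).measurableEmbedding

lemma heatMeasure_eq_map (T : ℝ) (x : EuclideanSpace ℝ (Fin n)) :
    heatMeasure T x = (Measure.pi fun _ : Fin n => gaussianReal 0 1).map
      fun p => x + Real.sqrt T • WithLp.toLp 2 p := by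
  rw [heatMeasure, ← map_pi_eq_stdGaussian, Measure.map_map (by fun_prop) (by fun_prop)]
  rfl

lemma integrable_heatMeasure_iff {T : ℝ} (hT : 0 < T) (x : EuclideanSpace ℝ (Fin n))
    {h : EuclideanSpace ℝ (Fin n) → ℝ} :
    Integrable h (heatMeasure T x) ↔
      Integrable fun p => h (x + Real.sqrt T • WithLp.toLp 2 p) * gaussDensity p := by
  rw [heatMeasure_eq_map, (measurableEmbedding_add_sqrt_smul hT x).integrable_map_iff,
    integrable_pi_gaussianReal_iff]
  rfl

lemma integral_heatMeasure {T : ℝ} (hT : 0 < T) (x : EuclideanSpace ℝ (Fin n))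
    (h : EuclideanSpace ℝ (Fin n) → ℝ) :
    ∫ y, h y ∂heatMeasure T x =
      ∫ p, h (x + Real.sqrt T • WithLp.toLp 2 p) * gaussDensity p := by
  rw [heatMeasure_eq_map, (measurableEmbedding_add_sqrt_smul hT x).integral_map,
    integral_pi_gaussianReal]

lemma heatSemigroup_eq_integral {T : ℝ} (hT : 0 < T) (x : EuclideanSpace ℝ (Fin n))
    (h : EuclideanSpace ℝ (Fin n) → ℝ) :
    heatSemigroup T h x = ∫ y, h y ∂heatMeasure T x := by
  have hs : Real.sqrt T ≠ 0 := (Real.sqrt_pos.2 hT).ne'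
  have h2 : MeasurableEmbedding fun z : EuclideanSpace ℝ (Fin n) => x + Real.sqrt T • z :=
    ((Homeomorph.smulOfNeZero _ hs).trans (Homeomorph.addLeft x)).measurableEmbedding
  rw [heatSemigroup, heatMeasure, h2.integral_map]

lemma gaussDensity_eq_exp (p : Fin n → ℝ) :
    gaussDensity p =
      Real.exp (-(n / 2 * Real.log (2 * Real.pi)) - (∑ i, p i ^ 2) / 2) := by
  rw [← log_gaussDensity, Real.exp_log (gaussDensity_pos p)]

lemma gaussDensity_sub (p : Fin n → ℝ) (k : EuclideanSpace ℝ (Fin n)) :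
    gaussDensity (p - k.ofLp) =
      Real.exp (-(‖k‖ ^ 2 / 2)) * (Real.exp (inner ℝ (WithLp.toLp 2 p) k) * gaussDensity p) := by
  rw [gaussDensity_eq_exp, gaussDensity_eq_exp, ← Real.exp_add, ← Real.exp_add]
  congr 1
  have h1 : ‖k‖ ^ 2 = ∑ i, k i ^ 2 := by
    rw [EuclideanSpace.norm_sq_eq]
    simp
  have h2 : inner ℝ (WithLp.toLp 2 p) k = ∑ i, p i * k i := by
    simp [PiLp.inner_apply, mul_comm]
  have h3 : ∑ i, (p - k.ofLp) i ^ 2 =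
      (∑ i, p i ^ 2) - 2 * (∑ i, p i * k i) + ∑ i, k i ^ 2 := by
    rw [Finset.mul_sum, ← Finset.sum_sub_distrib, ← Finset.sum_add_distrib]
    refine Finset.sum_congr rfl fun i _ => ?_
    simp only [Pi.sub_apply]
    ring
  rw [h1, h2, h3]
  ring

/-- The Cameron–Martin shift: moving the base point of the heat semigroup amounts to an exponential
tilt of the Gaussian density. -/
lemma cameron_martin_integrand {T : ℝ} (hT : 0 < T) (x y : EuclideanSpace ℝ (Fin n))
    (f : EuclideanSpace ℝ (Fin n) → ℝ) (p : Fin n → ℝ) :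
    f (y + Real.sqrt T • WithLp.toLp 2 (p - ((Real.sqrt T)⁻¹ • (y - x)).ofLp)) *
        gaussDensity (p - ((Real.sqrt T)⁻¹ • (y - x)).ofLp) =
      Real.exp (-(‖(Real.sqrt T)⁻¹ • (y - x)‖ ^ 2 / 2)) *
        (Real.exp (inner ℝ (WithLp.toLp 2 p) ((Real.sqrt T)⁻¹ • (y - x))) *
          (f (x + Real.sqrt T • WithLp.toLp 2 p) * gaussDensity p)) := by
  have hs : Real.sqrt T ≠ 0 := (Real.sqrt_pos.2 hT).ne'
  rw [gaussDensity_sub, WithLp.toLp_sub, WithLp.toLp_ofLp, smul_sub, smul_inv_smul₀ hs]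
  rw [show y + (Real.sqrt T • WithLp.toLp 2 p - (y - x)) = x + Real.sqrt T • WithLp.toLp 2 p by
    abel]
  ring

/-- The heat semigroup at `y` as an exponential integral of the density at `x`, in the variable
`k = (y - x) / √T`. -/
lemma heatSemigroup_eq_tilted {T : ℝ} (hT : 0 < T) (x y : EuclideanSpace ℝ (Fin n))
    (f : EuclideanSpace ℝ (Fin n) → ℝ) :
    heatSemigroup T f y = Real.exp (-(‖(Real.sqrt T)⁻¹ • (y - x)‖ ^ 2 / 2)) *
      ∫ p, Real.exp (inner ℝ (WithLp.toLp 2 p) ((Real.sqrt T)⁻¹ • (y - x))) *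
        (f (x + Real.sqrt T • WithLp.toLp 2 p) * gaussDensity p) := by
  rw [heatSemigroup_eq_integral hT, integral_heatMeasure hT, ← integral_const_mul,
    ← integral_sub_right_eq_self _ ((Real.sqrt T)⁻¹ • (y - x)).ofLp]
  exact integral_congr_ae (Eventually.of_forall fun p => cameron_martin_integrand hT x y f p)

lemma integrable_tilted {T : ℝ} (hT : 0 < T) (x y : EuclideanSpace ℝ (Fin n))
    {f : EuclideanSpace ℝ (Fin n) → ℝ} (hf : Integrable f (heatMeasure T y)) :
    Integrable fun p => Real.exp (inner ℝ (WithLp.toLp 2 p) ((Real.sqrt T)⁻¹ • (y - x))) *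
        (f (x + Real.sqrt T • WithLp.toLp 2 p) * gaussDensity p) := by
  have h := ((integrable_heatMeasure_iff hT y).1 hf).comp_sub_right
    ((Real.sqrt T)⁻¹ • (y - x)).ofLp
  simp_rw [cameron_martin_integrand hT x y f] at h
  refine (h.const_mul (Real.exp (‖(Real.sqrt T)⁻¹ • (y - x)‖ ^ 2 / 2))).congr
    (Eventually.of_forall fun p => ?_)
  simp only
  rw [← mul_assoc, ← Real.exp_add, add_neg_cancel, Real.exp_zero, one_mul]

/-- The exponential of a multiple of the sup norm is controlled by exponentials of coordinates, that
is, by finitely many exponential tilts. -/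
lemma exp_mul_pi_norm_le {ε : ℝ} (p : Fin n → ℝ) :
    Real.exp (ε * ‖p‖) ≤ 1 + ∑ i, (Real.exp (ε * p i) + Real.exp (-(ε * p i))) := by
  have hnn : ∀ i, 0 ≤ Real.exp (ε * p i) + Real.exp (-(ε * p i)) := fun i => by positivity
  by_cases h0 : ‖p‖ = 0
  · rw [h0, mul_zero, Real.exp_zero]
    linarith [Finset.sum_nonneg fun i (_ : i ∈ Finset.univ) => hnn i]
  obtain ⟨i, hi⟩ : ∃ i, ‖p‖ ≤ |p i| := by
    by_contra! h
    exact lt_irrefl _ ((pi_norm_lt_iff (lt_of_le_of_ne (norm_nonneg p) (Ne.symm h0))).2 h)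
  have hi' : ‖p‖ = |p i| := le_antisymm hi (norm_le_pi_norm p i)
  have h1 : Real.exp (ε * ‖p‖) ≤ Real.exp (ε * p i) + Real.exp (-(ε * p i)) := by
    rw [hi']
    rcases abs_cases (p i) with h | h
    · rw [h.1]
      linarith [Real.exp_pos (-(ε * p i))]
    · rw [h.1, mul_neg]
      linarith [Real.exp_pos (ε * p i)]
  have h2 := Finset.single_le_sum (fun j _ => hnn j) (Finset.mem_univ i)
  linarith

/-- Finiteness of the heat semigroup near `x` yields an exponential moment for the density. -/
lemma exists_integrable_exp_norm {T : ℝ} (hT : 0 < T) {x : EuclideanSpace ℝ (Fin n)}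
    {f : EuclideanSpace ℝ (Fin n) → ℝ} (hf : Continuous f)
    (hfin : ∀ᶠ y in 𝓝 x, Integrable f (heatMeasure T y)) :
    ∃ r : ℝ, 0 < r ∧ Integrable fun p : Fin n → ℝ => Real.exp (r * ‖WithLp.toLp 2 p‖) *
      ‖f (x + Real.sqrt T • WithLp.toLp 2 p) * gaussDensity p‖ := by
  have hs : 0 < Real.sqrt T := Real.sqrt_pos.2 hT
  set ρ : (Fin n → ℝ) → ℝ := fun p => f (x + Real.sqrt T • WithLp.toLp 2 p) * gaussDensity p
  have hρ : Continuous ρ := by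
    have := continuous_gaussDensity (n := n)
    fun_prop
  obtain ⟨δ, hδ, hball⟩ := Metric.eventually_nhds_iff.1 hfin
  have htilt : ∀ k : EuclideanSpace ℝ (Fin n), Real.sqrt T * ‖k‖ < δ →
      Integrable fun p => Real.exp (inner ℝ (WithLp.toLp 2 p) k) * ρ p := by
    intro k hk
    have h := integrable_tilted hT x (x + Real.sqrt T • k) (hball (by
      rwa [dist_eq_norm, add_sub_cancel_left, norm_smul, Real.norm_of_nonneg hs.le]))
    rwa [add_sub_cancel_left, inv_smul_smul₀ hs.ne'] at h
  obtain ⟨ε, hε, hεδ⟩ : ∃ ε : ℝ, 0 < ε ∧ Real.sqrt T * ε < δ :=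
    ⟨δ / (2 * Real.sqrt T), by positivity, by field_simp; linarith⟩
  have hcoord : ∀ (i : Fin n) (a : ℝ), |a| = ε →
      Integrable fun p : Fin n → ℝ => Real.exp (a * p i) * ‖ρ p‖ := by
    intro i a ha
    have h := (htilt (EuclideanSpace.single i a) (by simpa [ha] using hεδ)).norm
    refine h.congr (Eventually.of_forall fun p => ?_)
    simp only [norm_mul, Real.norm_of_nonneg (Real.exp_pos _).le]
    rw [EuclideanSpace.inner_single_right]
    simp
  have h0 : Integrable fun p => ‖ρ p‖ := by
    have h := (htilt 0 (by simpa using hδ)).norm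
    simpa using h
  let L : (Fin n → ℝ) →L[ℝ] EuclideanSpace ℝ (Fin n) :=
    ((PiLp.continuousLinearEquiv 2 ℝ fun _ : Fin n => ℝ).symm :
      (Fin n → ℝ) →L[ℝ] EuclideanSpace ℝ (Fin n))
  set K := ‖L‖ + 1
  have hL : ∀ p : Fin n → ℝ, ‖WithLp.toLp 2 p‖ ≤ K * ‖p‖ :=
    fun p => (L.le_opNorm p).trans
      (mul_le_mul_of_nonneg_right (le_add_of_nonneg_right zero_le_one) (norm_nonneg _))
  have hK : 0 < K := by positivity
  refine ⟨ε / K, by positivity, ?_⟩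
  have hbound : Integrable fun p => ‖ρ p‖ +
      ∑ i, (Real.exp (ε * p i) * ‖ρ p‖ + Real.exp (-ε * p i) * ‖ρ p‖) :=
    h0.add (integrable_finsetSum _ fun i _ =>
      (hcoord i ε (abs_of_pos hε)).add (hcoord i (-ε) (by rw [abs_neg, abs_of_pos hε])))
  refine hbound.mono' ?_ (Eventually.of_forall fun p => ?_)
  · have : Continuous fun p : Fin n → ℝ => Real.exp (ε / K * ‖WithLp.toLp 2 p‖) * ‖ρ p‖ := by
      fun_prop
    exact this.aestronglyMeasurable
  · rw [norm_mul, norm_norm, Real.norm_of_nonneg (Real.exp_pos _).le]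
    have h1 : Real.exp (ε / K * ‖WithLp.toLp 2 p‖) ≤ Real.exp (ε * ‖p‖) := by
      refine Real.exp_le_exp.2 ?_
      calc ε / K * ‖WithLp.toLp 2 p‖ ≤ ε / K * (K * ‖p‖) := by gcongr; exact hL p
        _ = ε * ‖p‖ := by field_simp
    calc _ ≤ (1 + ∑ i, (Real.exp (ε * p i) + Real.exp (-(ε * p i)))) * ‖ρ p‖ :=
          mul_le_mul_of_nonneg_right (h1.trans (exp_mul_pi_norm_le p)) (norm_nonneg _)
      _ = _ := by
          rw [add_mul, one_mul, Finset.sum_mul]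
          simp_rw [add_mul, neg_mul]

lemma integrable_mul_sq_of_exp {ρ : (Fin n → ℝ) → ℝ} (hρ : Continuous ρ) {r : ℝ} (hr : 0 < r)
    (hint : Integrable fun p : Fin n → ℝ => Real.exp (r * ‖WithLp.toLp 2 p‖) * ‖ρ p‖)
    (i : Fin n) : Integrable fun p => ρ p * p i ^ 2 := by
  refine (hint.const_mul (2 / r ^ 2)).mono' (by fun_prop) (Eventually.of_forall fun p => ?_)
  have h1 := Real.pow_div_factorial_le_exp (r * ‖WithLp.toLp 2 p‖) (by positivity) 2
  have h2 : p i ^ 2 ≤ ‖WithLp.toLp 2 p‖ ^ 2 := by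
    have := PiLp.norm_apply_le (WithLp.toLp 2 p) i
    rw [← sq_abs (p i)]
    exact pow_le_pow_left₀ (abs_nonneg _) this 2
  have h3 : p i ^ 2 ≤ 2 / r ^ 2 * Real.exp (r * ‖WithLp.toLp 2 p‖) := by
    refine h2.trans ?_
    rw [div_mul_eq_mul_div, le_div_iff₀ (by positivity)]
    simp only [Nat.factorial, mul_pow] at h1
    norm_num at h1
    linarith
  rw [norm_mul, Real.norm_of_nonneg (sq_nonneg _), mul_comm, ← mul_assoc]
  exact mul_le_mul_of_nonneg_right h3 (norm_nonneg _)

/-! ### Hessians -/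

lemma hessianMatrix_apply (g : EuclideanSpace ℝ (Fin n) → ℝ) (x : EuclideanSpace ℝ (Fin n))
    (i j : Fin n) : hessianMatrix g x i j =
      fderiv ℝ (fderiv ℝ g) x (EuclideanSpace.single i 1) (EuclideanSpace.single j 1) := by
  simp [hessianMatrix, iteratedFDeriv_two_apply]

lemma laplacian_eq_sum_hessianMatrix (g : EuclideanSpace ℝ (Fin n) → ℝ)
    (x : EuclideanSpace ℝ (Fin n)) : Laplacian.laplacian g x = ∑ i, hessianMatrix g x i i := by
  rw [InnerProductSpace.laplacian_eq_iteratedFDeriv_orthonormalBasis g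
    (EuclideanSpace.basisFun (Fin n) ℝ)]
  simp [hessianMatrix]

lemma contDiff_log_gaussDensity {m : WithTop ℕ∞} :
    ContDiff ℝ m fun p : Fin n → ℝ => Real.log (gaussDensity p) := by
  simp_rw [log_gaussDensity]
  fun_prop

lemma fderiv_fderiv_log_gaussDensity (p v w : Fin n → ℝ) :
    fderiv ℝ (fderiv ℝ fun p : Fin n → ℝ => Real.log (gaussDensity p)) p v w = -(v ⬝ᵥ w) := by
  set Q : (Fin n → ℝ) →L[ℝ] (Fin n → ℝ) →L[ℝ] ℝ := ∑ j,
    (ContinuousLinearMap.proj j : (Fin n → ℝ) →L[ℝ] ℝ).smulRight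
      (-(ContinuousLinearMap.proj j : (Fin n → ℝ) →L[ℝ] ℝ)) with hQ
  have h1 : fderiv ℝ (fun p : Fin n → ℝ => Real.log (gaussDensity p)) = Q := by
    ext1 q
    have hq : HasFDerivAt (fun p : Fin n → ℝ => ∑ i, p i ^ 2)
        (∑ j, (2 * q j) • (ContinuousLinearMap.proj j : (Fin n → ℝ) →L[ℝ] ℝ)) q := by
      refine HasFDerivAt.fun_sum fun j _ => ?_
      simpa using ((ContinuousLinearMap.proj j : (Fin n → ℝ) →L[ℝ] ℝ).hasFDerivAt (x := q)).pow 2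
    have h := (hq.mul_const (2⁻¹ : ℝ)).const_sub (-(n / 2 * Real.log (2 * Real.pi)))
    simp_rw [log_gaussDensity, div_eq_mul_inv (∑ i, _ ^ 2 : ℝ)]
    rw [h.fderiv]
    ext u
    simp [hQ, Finset.mul_sum]
    exact Finset.sum_congr rfl fun i _ => by ring
  rw [h1, Q.fderiv]
  simp [hQ, dotProduct]

/-- The Hessian of the logarithm of the density in Gaussian coordinates. -/
lemma fderiv_fderiv_log_density {T : ℝ} (hT : 0 < T) (x : EuclideanSpace ℝ (Fin n))
    {h : EuclideanSpace ℝ (Fin n) → ℝ} (hh : ContDiff ℝ 2 h) (p : Fin n → ℝ) (i j : Fin n) :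
    fderiv ℝ (fderiv ℝ fun p : Fin n → ℝ =>
        h (x + Real.sqrt T • WithLp.toLp 2 p) + Real.log (gaussDensity p)) p
        (Pi.single i 1) (Pi.single j 1) =
      T * hessianMatrix h (x + Real.sqrt T • WithLp.toLp 2 p) i j -
        (1 : Matrix (Fin n) (Fin n) ℝ) i j := by
  set A : (Fin n → ℝ) →L[ℝ] EuclideanSpace ℝ (Fin n) :=
    Real.sqrt T • ((PiLp.continuousLinearEquiv 2 ℝ fun _ : Fin n => ℝ).symm :
      (Fin n → ℝ) →L[ℝ] EuclideanSpace ℝ (Fin n)) with hA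
  have hAp : ∀ p, A p = Real.sqrt T • WithLp.toLp 2 p := fun p => rfl
  simp_rw [← hAp]
  have hd : Differentiable ℝ h := hh.differentiable (by norm_num)
  have hd2 : Differentiable ℝ (fderiv ℝ h) :=
    (hh.fderiv_right (m := 1) (by norm_num)).differentiable (by norm_num)
  have hAd : ∀ q, HasFDerivAt (fun q => x + A q) A q := fun q => A.hasFDerivAt.const_add x
  have hgd : Differentiable ℝ fun p : Fin n → ℝ => Real.log (gaussDensity p) :=
    (contDiff_log_gaussDensity (m := 2)).differentiable (by norm_num)
  have hgd2 : Differentiable ℝ (fderiv ℝ fun p : Fin n → ℝ => Real.log (gaussDensity p)) :=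
    ((contDiff_log_gaussDensity (m := 2)).fderiv_right (m := 1) (by norm_num)).differentiable
      (by norm_num)
  have h1 : ∀ q, HasFDerivAt (fun q => h (x + A q)) ((fderiv ℝ h (x + A q)).comp A) q := fun q =>
    (hd _).hasFDerivAt.comp q (hAd q)
  have h2 : (fderiv ℝ fun q => h (x + A q) + Real.log (gaussDensity q)) = fun q =>
      (fderiv ℝ h (x + A q)).comp A + fderiv ℝ (fun q => Real.log (gaussDensity q)) q :=
    funext fun q => ((h1 q).add (hgd q).hasFDerivAt).fderiv
  have h3 : HasFDerivAt (fun q => fderiv ℝ h (x + A q))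
      ((fderiv ℝ (fderiv ℝ h) (x + A p)).comp A) p := (hd2 _).hasFDerivAt.comp p (hAd p)
  have h4 := ((h3.clm_comp (hasFDerivAt_const A p)).add (hgd2 p).hasFDerivAt)
  rw [h2]
  erw [h4.fderiv]
  have hsingle : ∀ i, A (Pi.single i 1) = Real.sqrt T • EuclideanSpace.single i 1 := fun i => by
    rw [hAp, PiLp.toLp_single]
  rw [add_apply, add_apply, fderiv_fderiv_log_gaussDensity, hessianMatrix_apply]
  have h5 : (Pi.single i 1 : Fin n → ℝ) ⬝ᵥ Pi.single j 1 = (1 : Matrix (Fin n) (Fin n) ℝ) i j := by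
    rw [single_one_dotProduct, Matrix.one_apply, Pi.single_apply]
  have h6 : fderiv ℝ (fderiv ℝ h) (x + A p) (A (Pi.single i 1)) (A (Pi.single j 1)) =
      T * fderiv ℝ (fderiv ℝ h) (x + A p) (EuclideanSpace.single i 1)
        (EuclideanSpace.single j 1) := by
    rw [hsingle, hsingle, map_smul, map_smul, smul_apply, smul_smul, Real.mul_self_sqrt hT.le,
      smul_eq_mul]
  rw [h5, ← h6, sub_eq_add_neg, ContinuousLinearMap.comp_zero, zero_add]
  rfl

/-! ### Derivatives of the heat semigroup -/

section

variable {E : Type*} [NormedAddCommGroup E] [InnerProductSpace ℝ E]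

lemma fderiv_half_norm_sq (k : E) : fderiv ℝ (fun k : E => ‖k‖ ^ 2 / 2) k = innerSL ℝ k := by
  have h := ((hasStrictFDerivAt_norm_sq k).hasFDerivAt).mul_const (2⁻¹ : ℝ)
  simp_rw [div_eq_mul_inv]
  rw [h.fderiv]
  ext v
  simp

/-- Second-order behaviour at the origin of a function multiplied by the Gaussian weight
`exp (-‖k‖² / 2)`, and of its logarithm. -/
lemma gaussian_mul_second_order {Λ G : E → ℝ} (hG : G = fun k => Real.exp (-(‖k‖ ^ 2 / 2)) * Λ k)
    (hΛ : ContDiffAt ℝ 2 Λ 0) (h1 : Λ 0 = 1) :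
    ContDiffAt ℝ 2 G 0 ∧
    (∀ v w, fderiv ℝ (fderiv ℝ G) 0 v w =
      fderiv ℝ (fderiv ℝ Λ) 0 v w - inner ℝ v w) ∧
    ∀ v w, fderiv ℝ (fderiv ℝ fun k => Real.log (G k)) 0 v w =
      fderiv ℝ (fderiv ℝ Λ) 0 v w - fderiv ℝ Λ 0 v * fderiv ℝ Λ 0 w - inner ℝ v w := by
  have hpos : 0 < Λ 0 := by rw [h1]; exact one_pos
  have hq : ContDiff ℝ 2 fun k : E => ‖k‖ ^ 2 / 2 := (contDiff_norm_sq ℝ).div_const 2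
  have hlog : ContDiffAt ℝ 2 (fun k => Real.log (Λ k)) 0 := hΛ.log hpos.ne'
  set u : E → ℝ := fun k => Real.log (Λ k) - ‖k‖ ^ 2 / 2 with hu_def
  have hu : ContDiffAt ℝ 2 u 0 := hlog.sub hq.contDiffAt
  have hexp : G =ᶠ[𝓝 0] fun k => Real.exp (u k) := by
    filter_upwards [hΛ.continuousAt.eventually (lt_mem_nhds hpos)] with k hk
    simp only [hG, hu_def]
    rw [sub_eq_add_neg, Real.exp_add, Real.exp_log hk, mul_comm]
  have hlogexp : (fun k => Real.log (G k)) =ᶠ[𝓝 0] u := by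
    filter_upwards [hexp] with k hk
    rw [hk, Real.log_exp]
  have hu1 : fderiv ℝ u =ᶠ[𝓝 0] fun k => fderiv ℝ (fun k => Real.log (Λ k)) k - innerSL ℝ k := by
    filter_upwards [hlog.eventually (by simp)] with k hk
    rw [hu_def, fderiv_fun_sub (hk.differentiableAt (by norm_num))
      (hq.differentiable (by norm_num) k), fderiv_half_norm_sq]
  have hd : DifferentiableAt ℝ (fderiv ℝ fun k => Real.log (Λ k)) 0 :=
    (hlog.fderiv_right (m := 1) (by norm_num)).differentiableAt (by norm_num)
  -- Over `ℝ` the conjugate-linear inner product map is linear.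
  let I : E →L[ℝ] E →L[ℝ] ℝ := innerSL ℝ
  have hu2 : ∀ v w, fderiv ℝ (fderiv ℝ u) 0 v w =
      fderiv ℝ (fderiv ℝ Λ) 0 v w - fderiv ℝ Λ 0 v * fderiv ℝ Λ 0 w - inner ℝ v w := by
    intro v w
    have h2 : fderiv ℝ (fderiv ℝ u) 0 = fderiv ℝ (fderiv ℝ fun k => Real.log (Λ k)) 0 - I := by
      rw [hu1.fderiv_eq]
      exact (hd.hasFDerivAt.sub I.hasFDerivAt).fderiv
    rw [h2, sub_apply, sub_apply, fderiv_fderiv_log hΛ hpos, h1,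
      show I v w = inner ℝ v w from rfl]
    simp
  have hu0 : ∀ v, fderiv ℝ u 0 v = fderiv ℝ Λ 0 v := by
    intro v
    have h := hu1.self_of_nhds
    simp only [fderiv.log (hΛ.differentiableAt (by norm_num)) hpos.ne', h1] at h
    simp [h]
  have hu00 : u 0 = 0 := by simp [hu_def, h1]
  refine ⟨(hu.exp).congr_of_eventuallyEq hexp, fun v w => ?_, fun v w => ?_⟩
  · rw [hexp.fderiv.fderiv_eq, fderiv_fderiv_exp hu, hu2, hu0, hu0, hu00, Real.exp_zero]
    ring
  · rw [hlogexp.fderiv.fderiv_eq, hu2]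

end

/-- At its base point, the heat semigroup applied to a density of total mass one is twice
differentiable, and its derivatives are moments of the density in Gaussian coordinates. -/
lemma heatSemigroup_second_order {T : ℝ} (hT : 0 < T) {x : EuclideanSpace ℝ (Fin n)}
    {f : EuclideanSpace ℝ (Fin n) → ℝ} (hf : Continuous f)
    {ρ : (Fin n → ℝ) → ℝ}
    (hρ : ρ = fun p => f (x + Real.sqrt T • WithLp.toLp 2 p) * gaussDensity p)
    (h1 : ∫ p, ρ p = 1) {r : ℝ} (hr : 0 < r)
    (hint : Integrable fun p : Fin n → ℝ => Real.exp (r * ‖WithLp.toLp 2 p‖) * ‖ρ p‖) :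
    ContDiffAt ℝ 2 (heatSemigroup T f) x ∧
    (∀ i j, T * hessianMatrix (heatSemigroup T f) x i j =
      (∫ p, ρ p * (p i * p j)) - (1 : Matrix (Fin n) (Fin n) ℝ) i j) ∧
    ∀ i j, T * hessianMatrix (fun w => Real.log (heatSemigroup T f w)) x i j =
      (∫ p, ρ p * (p i * p j)) - (∫ p, ρ p * p i) * (∫ p, ρ p * p j) -
        (1 : Matrix (Fin n) (Fin n) ℝ) i j := by
  have hρc : Continuous ρ := by
    have := continuous_gaussDensity (n := n)
    rw [hρ]
    fun_prop
  obtain ⟨hc, hd1, hd2⟩ := exp_integral_second_order (Y := fun p : Fin n → ℝ => WithLp.toLp 2 p)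
    (by fun_prop) hr hρc.aestronglyMeasurable hint
  set Λ : EuclideanSpace ℝ (Fin n) → ℝ :=
    fun k => ∫ p, Real.exp (inner ℝ (WithLp.toLp 2 p) k) * ρ p with hΛ
  have hΛ0 : Λ 0 = 1 := by simpa [hΛ] using h1
  obtain ⟨G, hG⟩ : ∃ G : EuclideanSpace ℝ (Fin n) → ℝ,
    G = fun k => Real.exp (-(‖k‖ ^ 2 / 2)) * Λ k := ⟨_, rfl⟩
  obtain ⟨gc, g2, gl⟩ := gaussian_mul_second_order hG hc hΛ0
  have hP : heatSemigroup T f = fun y => G ((Real.sqrt T)⁻¹ • (y - x)) := by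
    ext y
    rw [heatSemigroup_eq_tilted hT x y f]
    simp only [hG, hΛ, hρ]
  have hsq : T * (Real.sqrt T)⁻¹ ^ 2 = 1 := by
    rw [inv_pow, Real.sq_sqrt hT.le, mul_inv_cancel₀ hT.ne']
  have hinner : ∀ (p : Fin n → ℝ) (i : Fin n),
      inner ℝ (WithLp.toLp 2 p) (EuclideanSpace.single i (1 : ℝ)) = p i := fun p i => by
    rw [EuclideanSpace.inner_single_right]
    simp
  have hone : ∀ i j : Fin n, inner ℝ (EuclideanSpace.single i (1 : ℝ))
      (EuclideanSpace.single j (1 : ℝ)) = (1 : Matrix (Fin n) (Fin n) ℝ) i j := fun i j => by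
    rw [EuclideanSpace.inner_single_right, Matrix.one_apply]
    simp [eq_comm]
  have hm2 : ∀ i j : Fin n, ∫ p : Fin n → ℝ, p i * p j * ρ p = ∫ p, ρ p * (p i * p j) :=
    fun i j => by simp_rw [mul_comm (ρ _)]
  have hm1 : ∀ i : Fin n, ∫ p : Fin n → ℝ, p i * ρ p = ∫ p, ρ p * p i :=
    fun i => by simp_rw [mul_comm (ρ _)]
  refine ⟨?_, fun i j => ?_, fun i j => ?_⟩
  · rw [hP]
    have h : ContDiffAt ℝ 2 (fun y : EuclideanSpace ℝ (Fin n) => (Real.sqrt T)⁻¹ • (y - x)) x := by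
      fun_prop
    refine ContDiffAt.comp x ?_ h
    simpa using gc
  · rw [hessianMatrix_apply, hP, fderiv_fderiv_comp_smul_sub, sub_self, smul_zero, g2, hd2,
      ← mul_assoc, hsq, one_mul, hone]
    simp_rw [hinner]
    rw [hm2]
  · rw [hessianMatrix_apply, hP, fderiv_fderiv_comp_smul_sub (fun k => Real.log (G k)), sub_self, smul_zero, gl, hd2, hd1, hd1,
      ← mul_assoc, hsq, one_mul, hone]
    simp_rw [hinner]
    rw [hm2, hm1, hm1]

/-! ### Relative entropy in Gaussian coordinates -/

instance isProbabilityMeasure_heatMeasure (T : ℝ) (x : EuclideanSpace ℝ (Fin n)) :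
    IsProbabilityMeasure (heatMeasure T x) :=
  Measure.isProbabilityMeasure_map (by fun_prop)

/-- The relative entropy as a Lebesgue integral; it is infinite exactly when the integrand fails to be
integrable. -/
lemma klDiv_heatMeasure {T : ℝ} (hT : 0 < T) {x : EuclideanSpace ℝ (Fin n)}
    {f : EuclideanSpace ℝ (Fin n) → ℝ} (hf : Continuous f) (hpos : ∀ y, 0 < f y)
    (hnorm : ∫ y, f y ∂heatMeasure T x = 1) {μ : Measure (EuclideanSpace ℝ (Fin n))}
    (hμ : μ = (heatMeasure T x).withDensity (fun y => ENNReal.ofReal (f y)))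
    {F : (Fin n → ℝ) → ℝ}
    (hF : F = fun p => f (x + Real.sqrt T • WithLp.toLp 2 p) *
      Real.log (f (x + Real.sqrt T • WithLp.toLp 2 p)) * gaussDensity p) :
    (Integrable F → (InformationTheory.klDiv μ (heatMeasure T x) : EReal) = (∫ p, F p : ℝ)) ∧
    (¬ Integrable F → InformationTheory.klDiv μ (heatMeasure T x) = ⊤) := by
  have hm : Measurable fun y => ENNReal.ofReal (f y) := hf.measurable.ennreal_ofReal
  have hac : μ ≪ heatMeasure T x := hμ ▸ withDensity_absolutelyContinuous _ _
  have hint : Integrable f (heatMeasure T x) := by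
    by_contra h
    rw [integral_undef h] at hnorm
    exact zero_ne_one hnorm
  have hprob : IsProbabilityMeasure μ := ⟨by
    rw [hμ, withDensity_apply _ MeasurableSet.univ, Measure.restrict_univ,
      ← ofReal_integral_eq_lintegral_ofReal hint (Eventually.of_forall fun y => (hpos y).le),
      hnorm, ENNReal.ofReal_one]⟩
  have hllr : llr μ (heatMeasure T x) =ᵐ[μ] fun y => Real.log (f y) := by
    refine hac.ae_le ?_
    filter_upwards [Measure.rnDeriv_withDensity (heatMeasure T x) hm] with y hy
    rw [llr_def]
    simp only
    rw [hμ, hy, ENNReal.toReal_ofReal (hpos y).le]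
  have hiff : Integrable (llr μ (heatMeasure T x)) μ ↔ Integrable F := by
    rw [integrable_congr hllr, hμ, integrable_withDensity_iff_integrable_smul' hm
      (Eventually.of_forall fun y => ENNReal.ofReal_lt_top), integrable_heatMeasure_iff hT, hF]
    simp_rw [ENNReal.toReal_ofReal (hpos _).le, smul_eq_mul]
  refine ⟨fun h => ?_, fun h => InformationTheory.klDiv_of_not_integrable (mt hiff.1 h)⟩
  have hval : ∫ y, llr μ (heatMeasure T x) y ∂μ = ∫ p, F p := by
    rw [integral_congr_ae hllr, hμ, integral_withDensity_eq_integral_toReal_smul hm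
      (Eventually.of_forall fun y => ENNReal.ofReal_lt_top), integral_heatMeasure hT, hF]
    simp_rw [ENNReal.toReal_ofReal (hpos _).le, smul_eq_mul]
  have hnn := InformationTheory.integral_llr_add_sub_measure_univ_nonneg hac (hiff.2 h)
  rw [InformationTheory.klDiv_of_ac_of_integrable hac (hiff.2 h), EReal.coe_ennreal_ofReal,
    max_eq_left hnn, hval]
  simp

lemma integrable_mul_log_gaussDensity {ρ : (Fin n → ℝ) → ℝ} (h0 : Integrable ρ)
    (hsq : ∀ i, Integrable fun p => ρ p * p i ^ 2) :
    Integrable fun p => ρ p * Real.log (gaussDensity p) := by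
  simp_rw [log_gaussDensity, mul_sub, div_eq_mul_inv (∑ i, _ ^ 2 : ℝ), ← mul_assoc, Finset.mul_sum]
  exact (h0.mul_const _).sub ((integrable_finsetSum _ fun i _ => hsq i).mul_const _)

lemma integral_mul_log_gaussDensity {ρ : (Fin n → ℝ) → ℝ} (h1 : ∫ p, ρ p = 1)
    (h0 : Integrable ρ) (hsq : ∀ i, Integrable fun p => ρ p * p i ^ 2) :
    ∫ p, ρ p * Real.log (gaussDensity p) =
      -(n / 2 * Real.log (2 * Real.pi)) - (∑ i, ∫ p, ρ p * p i ^ 2) / 2 := by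
  simp_rw [log_gaussDensity, mul_sub, div_eq_mul_inv (∑ i, _ ^ 2 : ℝ), ← mul_assoc, Finset.mul_sum]
  rw [integral_sub (h0.mul_const _) ((integrable_finsetSum _ fun i _ => hsq i).mul_const _),
    integral_mul_const, integral_mul_const, integral_finsetSum _ fun i _ => hsq i, h1, one_mul]
  ring

end HeatEntropy

open HeatEntropy in
theorem mainTheorem5 (n : ℕ) (T : ℝ) (hT : 0 < T) (x : EuclideanSpace ℝ (Fin n))
    (f : EuclideanSpace ℝ (Fin n) → ℝ) (hf : ContDiff ℝ ∞ f) (hpos : ∀ y, 0 < f y)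
    (hnorm : ∫ y, f y ∂heatMeasure T x = 1)
    (hfin : ∀ᶠ y in 𝓝 x, Integrable f (heatMeasure T y))
    (μ : Measure (EuclideanSpace ℝ (Fin n)))
    (hμ : μ = (heatMeasure T x).withDensity (fun y => ENNReal.ofReal (f y))) :
    ContDiffAt ℝ 2 (heatSemigroup T f) x ∧
    ((∀ i j, Integrable (fun y => f y * hessianMatrix (fun w => Real.log (f w)) y i j)
        (heatMeasure T x)) →
      0 < (1 - (T / heatSemigroup T f x) • heatHessianLog T f x).det ∧
      (InformationTheory.klDiv μ (heatMeasure T x) : EReal) ≤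
        ((T / 2 * Laplacian.laplacian (heatSemigroup T f) x
          + 1 / 2 * heatSemigroup T f x *
            Real.log (1 - (T / heatSemigroup T f x) • heatHessianLog T f x).det : ℝ) : EReal)) ∧
    (0 < (1 + T • hessianMatrix (fun w => Real.log (heatSemigroup T f w)) x).det ∧
      ((T / 2 * Laplacian.laplacian (heatSemigroup T f) x
          - 1 / 2 * heatSemigroup T f x *
            Real.log (1 + T • hessianMatrix (fun w => Real.log (heatSemigroup T f w)) x).det
              : ℝ) : EReal) ≤
        (InformationTheory.klDiv μ (heatMeasure T x) : EReal)) := by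
  obtain ⟨ρ, hρ⟩ : ∃ ρ : (Fin n → ℝ) → ℝ,
    ρ = fun p => f (x + Real.sqrt T • WithLp.toLp 2 p) * gaussDensity p := ⟨_, rfl⟩
  obtain ⟨F, hF⟩ : ∃ F : (Fin n → ℝ) → ℝ, F = fun p => f (x + Real.sqrt T • WithLp.toLp 2 p) *
      Real.log (f (x + Real.sqrt T • WithLp.toLp 2 p)) * gaussDensity p := ⟨_, rfl⟩
  have hρc : Continuous ρ := by
    have := continuous_gaussDensity (n := n)
    have := hf.continuous
    rw [hρ]
    fun_prop
  have hρpos : ∀ p, 0 < ρ p := fun p => by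
    rw [hρ]
    exact mul_pos (hpos _) (gaussDensity_pos p)
  have h1 : ∫ p, ρ p = 1 := by rw [← hnorm, integral_heatMeasure hT, hρ]
  have hPT : heatSemigroup T f x = 1 := by rw [heatSemigroup_eq_integral hT, hnorm]
  obtain ⟨r, hr, hexp⟩ := exists_integrable_exp_norm hT hf.continuous hfin
  have hexp' : Integrable fun p : Fin n → ℝ => Real.exp (r * ‖WithLp.toLp 2 p‖) * ‖ρ p‖ := by
    rwa [hρ]
  have h0 : Integrable ρ := by
    rw [hρ]
    exact (integrable_heatMeasure_iff hT x).1 hfin.self_of_nhds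
  have hsq := integrable_mul_sq_of_exp hρc hr hexp'
  obtain ⟨hC2, hHess, hHessLog⟩ := heatSemigroup_second_order hT hf.continuous hρ h1 hr hexp'
  obtain ⟨hKL, hKLtop⟩ := klDiv_heatMeasure hT hf.continuous hpos hnorm hμ hF
  -- `T / 2` times the Laplacian is the second-moment part of the relative entropy
  have hLap : T / 2 * Laplacian.laplacian (heatSemigroup T f) x =
      (∑ i, ∫ p, ρ p * p i ^ 2) / 2 - n / 2 := by
    have h : T * Laplacian.laplacian (heatSemigroup T f) x = (∑ i, ∫ p, ρ p * p i ^ 2) - n := by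
      rw [laplacian_eq_sum_hessianMatrix, Finset.mul_sum]
      simp_rw [hHess, ← sq]
      simp
    linarith
  -- the relative entropy differs from `∫ ρ log ρ` by the integral of a quadratic polynomial
  have hsplit : ∀ p, ρ p * Real.log (ρ p) = F p + ρ p * Real.log (gaussDensity p) := fun p => by
    simp only [hρ, hF]
    rw [Real.log_mul (hpos _).ne' (gaussDensity_pos p).ne']
    ring
  have hgi := integrable_mul_log_gaussDensity h0 hsq
  have hgv := integral_mul_log_gaussDensity h1 h0 hsq
  have hFint : (Integrable fun p => ρ p * Real.log (ρ p)) → Integrable F := fun h => by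
    refine (h.sub hgi).congr (Filter.Eventually.of_forall fun p => ?_)
    simp [hsplit]
  have hFval : Integrable F → ∫ p, F p = (∫ p, ρ p * Real.log (ρ p)) +
      n / 2 * Real.log (2 * Real.pi) + (∑ i, ∫ p, ρ p * p i ^ 2) / 2 := fun h => by
    simp_rw [hsplit]
    rw [integral_add h hgi, hgv]
    ring
  refine ⟨hC2, fun hA => ?_, ?_⟩
  · obtain ⟨V, hV⟩ : ∃ V : (Fin n → ℝ) → ℝ, V = fun p =>
      Real.log (f (x + Real.sqrt T • WithLp.toLp 2 p)) + Real.log (gaussDensity p) := ⟨_, rfl⟩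
    have hlogf : ContDiff ℝ 2 fun y => Real.log (f y) :=
      (contDiff_infty.1 hf 2).log fun y => (hpos y).ne'
    have hVρ : ∀ p, V p = Real.log (ρ p) := fun p => by
      simp only [hρ, hV]
      rw [Real.log_mul (hpos _).ne' (gaussDensity_pos p).ne']
    have hVexp : ∀ p, Real.exp (V p) = ρ p := fun p => by rw [hVρ, Real.exp_log (hρpos p)]
    have hV2 : ContDiff ℝ 2 V := by
      rw [hV]
      exact (hlogf.comp (by fun_prop)).add contDiff_log_gaussDensity
    -- the Hessian of the Gaussian factor contributes the identity matrix
    have hHessV : ∀ p i j, Real.exp (V p) *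
        fderiv ℝ (fderiv ℝ V) p (Pi.single i 1) (Pi.single j 1) =
        T * (f (x + Real.sqrt T • WithLp.toLp 2 p) *
          hessianMatrix (fun w => Real.log (f w)) (x + Real.sqrt T • WithLp.toLp 2 p) i j *
            gaussDensity p) - ρ p * (1 : Matrix (Fin n) (Fin n) ℝ) i j := fun p i j => by
      rw [hVexp, hV, fderiv_fderiv_log_density hT x hlogf, hρ]
      ring
    have hAi := fun i j => (integrable_heatMeasure_iff hT x).1 (hA i j)
    obtain ⟨hpd, hVi, hle⟩ := fisher_posDef_and_entropy_le hV2 (by simpa only [hVexp] using h1)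
      (by simpa only [hVexp] using hsq)
      (fun i j => by
        simp_rw [hHessV]
        exact ((hAi i j).const_mul T).sub (h0.mul_const _))
      (M := 1 - (T / heatSemigroup T f x) • heatHessianLog T f x) (by
        ext i j
        simp_rw [hHessV]
        rw [Matrix.of_apply, integral_sub ((hAi i j).const_mul T) (h0.mul_const _),
          integral_const_mul, integral_mul_const, h1, ← integral_heatMeasure hT x fun y =>
            f y * hessianMatrix (fun w => Real.log (f w)) y i j, ← heatSemigroup_eq_integral hT,
          hPT]
        simp [heatHessianLog])
    simp only [hVρ, Real.exp_log (hρpos _)] at hVi hle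
    refine ⟨hpd.det_pos, ?_⟩
    rw [hKL (hFint hVi), EReal.coe_le_coe_iff, hFval (hFint hVi), hLap, hPT]
    rw [hPT] at hle
    linarith
  · obtain ⟨hpd, hle⟩ := covariance_posDef_and_le_entropy hρc hρpos h1 hsq
      (C := 1 + T • hessianMatrix (fun w => Real.log (heatSemigroup T f w)) x) (by
        ext i j
        rw [Matrix.add_apply, Matrix.smul_apply, smul_eq_mul, hHessLog, Matrix.of_apply]
        ring)
    refine ⟨hpd.det_pos, ?_⟩
    by_cases hFi : Integrable F
    · have hle := hle ((hFi.add hgi).congr (Filter.Eventually.of_forall fun p => (hsplit p).symm))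
      rw [hKL hFi, EReal.coe_le_coe_iff, hFval hFi, hLap, hPT]
      linarith
    -- if the integrand `F` is not integrable then the relative entropy is `⊤`
    · rw [hKLtop hFi]
      exact le_top
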